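/- Let $d\ge 1$, write $[k]=\{1,\dots,k\}$, and let $\rho\in[d]$. For a tuple $\mathbf n=(n_1,\dots,n_d)$ of non-negative integers, let $\mathcal T_\rho(\mathbf n)$ be the set of rooted trees with vertex set $\{(t,i): t\in[d],\, i\in[n_t]\}$ (the vertex $(t,i)$ has type $t$ and label $i$) whose root vertex has type $\rho$; the edges of a rooted tree are oriented toward its root, so that each edge goes from a child to its parent. A vertex of such a tree has complete degree type $(t,u,\mathbf c)$, where $t\in[d]$, $u\in[d+1]$ and $\mathbf c=(c_1,\dots,c_d)\in\mathbb N^d$ (with $0\in\mathbb N$), if it has type $t$, its parent has type $u$, and it has exactly $c_s$ children of type $s$ for every $s\in[d]$; by convention the fictitious parent of the root vertex has type $d+1$. Let $\mathbf N=(N_{t,u,\mathbf c})_{t\in[d],\,u\in[d+1],\,\mathbf c\in\mathbb N^d}$ be a tuple of non-negative integers, only finitely many of which are nonzero. Put $$m_{t,u}=\sum_{\mathbf c}N_{t,u,\mathbf c},\qquad m_{s,t,u}=\sum_{\mathbf c}c_s\,N_{t,u,\mathbf c},\qquad n_t=\sum_{u\in[d+1]}m_{t,u},\qquad N(k)=\sum_{\substack{s,t\in[d],\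 u\in[d+1],\ \mathbf c\\ c_s=k}}N_{t,u,\mathbf c},$$ and let $\vec{\mathcal T}_\rho^{\,\mathbf N}$ be the set of trees in $\mathcal T_\rho(\mathbf n)$ having exactly $N_{t,u,\mathbf c}$ vertices of complete degree type $(t,u,\mathbf c)$, for all $t\in[d]$, $u\in[d+1]$, $\mathbf c\in\mathbb N^d$. If $$m_{s,d+1}=\delta_{s,\rho}\ \text{ for all } s\in[d]\qquad\text{and}\qquad m_{s,t}=\sum_{u\in[d+1]}m_{s,t,u}\ \text{ for all } s,t\in[d],$$ where $\delta$ is the Kronecker delta, then $$\bigl|\vec{\mathcal T}_\rho^{\,\mathbf N}\bigr|=\frac{\displaystyle\prod_{t\in[d]}n_t!\ \prod_{\substack{s,t\in[d]\\ m_{s,t}>0}}(m_{s,t}-1)!}{\displaystyle\prod_{t,u\in[d],\,\mathbf c}N_{t,u,\mathbf c}!\ \prod_{k\ge0}k!^{\,N(k)}}\times\sum_{A}\ \prod_{((s,t),(t,u))\in A}m_{s,t,u},$$ where $A$ runs over the spanning trees, oriented toward the vertex $(\rho,d+1)$, of the directed graph $G(\mathbf N)$ with vertex set $V=\{(t,u)\in[d]\times[d+1]: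 m_{t,u}>0\}$ and edge set $\{((s,t),(t,u)) : (s,t),(t,u)\in V\}$. If these conditions do not all hold, then $\vec{\mathcal T}_\rho^{\,\mathbf N}=\emptyset$. -/

import Mathlib

open scoped Nat

noncomputable section

/-- A rooted tree with vertex set `V`: a tree (a connected acyclic graph) together with a
distinguished vertex, its root. -/
@[ext]
structure RootedVertexTree (V : Type*) where
  graph : SimpleGraph V
  isTree : graph.IsTree
  root : V

namespace RootedVertexTree

variable {V : Type*}

instance [Finite V] : Finite (RootedVertexTree V) :=
  Finite.of_injective (fun T : RootedVertexTree V => (T.graph, T.root)) (by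
    intro S T h
    simp only [Prod.mk.injEq] at h
    exact RootedVertexTree.ext h.1 h.2)

instance [Finite V] : Fintype (RootedVertexTree V) := Fintype.ofFinite _

/-- The tree with its edges oriented toward the root: there is an arc from `v` to `w` when
`v` and `w` are adjacent and `w` is the endpoint closer to the root,
i.e. `w` is the parent of `v` and `v` is a child of `w`. -/
def orientation (T : RootedVertexTree V) : Digraph V where
  Adj v w := T.graph.Adj v w ∧ T.graph.dist v T.root = T.graph.dist w T.root + 1

/-- The rooted tree `T`, with its edges oriented toward its root, is a spanning tree of the
digraph `G` (which may have loops). -/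
def IsSpanningTreeOf (T : RootedVertexTree V) (G : Digraph V) : Prop :=
  T.orientation ≤ G

open Classical in
/-- The finite set of the arcs `(v, w)` of a rooted tree oriented toward its root. -/
def arcs [Fintype V] (T : RootedVertexTree V) : Finset (V × V) :=
  {e | T.orientation.Adj e.1 e.2}

end RootedVertexTree

namespace MultitypeCayley

variable {d : ℕ}

/-- The vertex set `{(t, i) : t ∈ [d], i ∈ [n_t]}`; the vertex `⟨t, i⟩` has type `t`
and label `i`. -/
abbrev Vertex (n : Fin d → ℕ) : Type := Σ t : Fin d, Fin (n t)

/-- The set of rooted multitype Cayley trees of profile `n` in which the root vertex has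
type `ρ`. -/
def cayleyTrees (ρ : Fin d) (n : Fin d → ℕ) : Set (RootedVertexTree (Vertex n)) :=
  {T | T.root.1 = ρ}

/-- The number of children of type `s` of the vertex `v`. -/
def ch {n : Fin d → ℕ} (T : RootedVertexTree (Vertex n)) (s : Fin d) (v : Vertex n) : ℕ :=
  Nat.card {w : Vertex n // w.1 = s ∧ T.orientation.Adj w v}

/-- The parent of the vertex `v` has type `u ∈ [d + 1]`, where the last element of
`Fin (d + 1)` is by convention the type of the fictitious parent of the root vertex. -/
def HasParentType {n : Fin d → ℕ} (T : RootedVertexTree (Vertex n)) (v : Vertex n)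
    (u : Fin (d + 1)) : Prop :=
  (v = T.root ∧ u = Fin.last d) ∨ ∃ w : Vertex n, T.orientation.Adj v w ∧ u = w.1.castSucc

/-- The vertex `v` has complete degree type `(t, u, c)`: it has type `t`, its parent has
type `u`, and it has `c s` children of type `s` for every `s`. -/
def HasCompleteDegreeType {n : Fin d → ℕ} (T : RootedVertexTree (Vertex n)) (v : Vertex n)
    (t : Fin d) (u : Fin (d + 1)) (c : Fin d → ℕ) : Prop :=
  v.1 = t ∧ HasParentType T v u ∧ ∀ s, ch T s v = c s

/-- A tuple of non-negative integers `N_{t,u,c}` for `t ∈ [d]`, `u ∈ [d + 1]` and `c ∈ ℕ^d`,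
of which only finitely many are nonzero. -/
abbrev CompleteData (d : ℕ) : Type := Fin d → Fin (d + 1) → ((Fin d → ℕ) →₀ ℕ)

/-- `m_{t,u} = ∑_c N_{t,u,c}`. -/
def m₂ (N : CompleteData d) (t : Fin d) (u : Fin (d + 1)) : ℕ :=
  (N t u).sum fun _ a => a

/-- `m_{s,t,u} = ∑_c c_s N_{t,u,c}`. -/
def m₃ (N : CompleteData d) (s t : Fin d) (u : Fin (d + 1)) : ℕ :=
  (N t u).sum fun c a => c s * a

/-- `n_t = ∑_u m_{t,u}`. -/
def profile (N : CompleteData d) (t : Fin d) : ℕ :=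
  ∑ u : Fin (d + 1), m₂ N t u

/-- `N(k)` is the sum of `N_{t,u,c}` over all `s, t, u, c` such that `c_s = k`. -/
def indegreeCount (N : CompleteData d) (k : ℕ) : ℕ :=
  ∑ s : Fin d, ∑ t : Fin d, ∑ u : Fin (d + 1),
    (N t u).sum fun c a => if c s = k then a else 0

/-- The set of trees in `cayleyTrees ρ (profile N)` having `N_{t,u,c}` vertices of complete
degree type `(t, u, c)` for all `t`, `u` and `c`. -/
def treesWithData (ρ : Fin d) (N : CompleteData d) : Set (RootedVertexTree (Vertex (profile N))) :=
  {T | T ∈ cayleyTrees ρ (profile N) ∧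
    ∀ t u c, Nat.card {v // HasCompleteDegreeType T v t u c} = N t u c}

/-- The compatibility conditions `m_{s,d+1} = δ_{s,ρ}` for all `s ∈ [d]`, and
`m_{s,t} = ∑_{u ∈ [d+1]} m_{s,t,u}` for all `s, t ∈ [d]`. -/
def Compatible (ρ : Fin d) (N : CompleteData d) : Prop :=
  (∀ s, m₂ N s (Fin.last d) = if s = ρ then 1 else 0) ∧
    ∀ s t : Fin d, m₂ N s t.castSucc = ∑ u : Fin (d + 1), m₃ N s t u

/-- The vertices of `G(N)`: the pairs `(t, u) ∈ [d] × [d + 1]` with `m_{t,u} > 0`. -/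
abbrev GVertex (N : CompleteData d) : Type :=
  {x : Fin d × Fin (d + 1) // 0 < m₂ N x.1 x.2}

/-- The digraph `G(N)`: its edges go from `(s, t)` to `(t, u)` for all vertices of this form. -/
def G (N : CompleteData d) : Digraph (GVertex N) where
  Adj x y := x.1.2 = y.1.1.castSucc

open Classical in
/-- The sum, over the spanning trees `A` of `G(N)` oriented toward the vertex `(ρ, d + 1)`,
of the product of `m_{s,t,u}` over the edges `((s, t), (t, u))` of `A`. -/
def spanningTreeSum (ρ : Fin d) (N : CompleteData d) : ℕ :=
  ∑ A : RootedVertexTree (GVertex N) with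
      A.IsSpanningTreeOf (G N) ∧ A.root.1 = (ρ, Fin.last d),
    ∏ e ∈ A.arcs, m₃ N e.1.1.1 e.2.1.1 e.2.1.2

end MultitypeCayley

end

open scoped Nat

noncomputable section

/-! A rooted tree is encoded by its parent map, made to fix the root `r`; the maps that arise are
those fixing `r` under which every orbit reaches `r`. The count then splits in two.

(1) Assign to each vertex a parent type and child counts, compatibly with `N`. There are `∏ n_t! / ∏
N_{t,u,c}!` assignments (`card_isAssignment_mul`). Each is realised by the same number of trees, so
it remains to count the trees of one assignment `τ`.

(2) Let the class of a vertex be the pair (type, assigned parent type), a vertex of `G(N)`. A tree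
realises `τ` exactly when its parent map takes each value `w` a prescribed number of times on each
class (`degreeType_eq_iff`). Fix one map `f` with these fiber sizes, not necessarily a tree. All
others are `f ∘ g` with `g` a permutation preserving classes, and each arises `∏ c_s!` times
(`card_sameFiberCount_mul`). So it suffices to count the `g` for which `f ∘ g` is absorbing.

The heart is `card_absorbing_eq_quotient`: this number does not change if each class is collapsed to
one representative, because identifying two points `u`, `v` of a class preserves it, by an
involution that exchanges the images of `u` and `v` (`absorbing_comp_swap_iff`). After the collapse
only the images of the representatives matter, and the classes become independent. A class of size
`m` contributes `(m - 1)!` times the number of admissible images of its representative. Summing over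
absorbing maps on the classes gives the sum over spanning trees of `G(N)` (`card_parent_mul`). -/

/-- Every point eventually reaches `r` under iteration of `f`. -/
def Absorbing {V : Type*} (r : V) (f : V → V) : Prop := ∀ v, ∃ k, f^[k] v = r

/-! ### Depth in an absorbing map. -/

namespace Absorbing

variable {V : Type*} {r : V} {f : V → V}

open Classical in
/-- The number of iterations of `f` needed to reach `r`. -/
def depth (h : Absorbing r f) (v : V) : ℕ := Nat.find (h v)

lemma iterate_depth (h : Absorbing r f) (v : V) : f^[h.depth v] v = r := by
  classical exact Nat.find_spec (h v)

lemma depth_le (h : Absorbing r f) {v : V} {k : ℕ} (hk : f^[k] v = r) : h.depth v ≤ k := by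
  classical exact Nat.find_min' (h v) hk

lemma depth_root (h : Absorbing r f) : h.depth r = 0 :=
  Nat.le_zero.mp (h.depth_le rfl)

lemma depth_eq_succ (h : Absorbing r f) {v : V} (hv : v ≠ r) :
    h.depth v = h.depth (f v) + 1 := by
  apply le_antisymm
  · exact h.depth_le (by rw [Function.iterate_succ_apply]; exact h.iterate_depth _)
  · have h1 := h.iterate_depth v
    rcases hd : h.depth v with _ | k
    · rw [hd] at h1; exact absurd h1 hv
    · rw [hd, Function.iterate_succ_apply] at h1
      exact Nat.succ_le_succ (h.depth_le h1)

lemma apply_ne (h : Absorbing r f) {v : V} (hv : v ≠ r) : f v ≠ v := by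
  intro h1
  have := h.depth_eq_succ hv
  rw [h1] at this
  omega

/-- A point that returns to itself is the absorbing one. -/
lemma eq_of_periodic (h : Absorbing r f) (hr : f r = r) {v : V} {k : ℕ}
    (hk : f^[k + 1] v = v) : v = r := by
  have h2 : ∀ n, f^[(k + 1) * n] v = v := fun n => by
    rw [Function.iterate_mul]; exact Function.iterate_fixed hk n
  have h3 := h.iterate_depth v
  have h4 := h2 (h.depth v)
  -- After `depth v` steps the orbit sits at the fixed point `r`, so the remaining steps of this
  -- multiple of the period leave it there.
  rw [show (k + 1) * h.depth v = k * h.depth v + h.depth v by ring,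
    Function.iterate_add_apply, h3, Function.iterate_fixed hr] at h4
  exact h4.symm

end Absorbing

/-! ### Rooted trees as absorbing parent maps. -/

namespace RootedVertexTree

variable {V : Type*}

/-! ### The parent function of a rooted tree -/

lemma exists_orientation_adj (T : RootedVertexTree V) {v : V} (hv : v ≠ T.root) :
    ∃ w, T.orientation.Adj v w := by
  obtain ⟨p, hp⟩ := T.isTree.connected.exists_walk_length_eq_dist v T.root
  cases p with
  | nil => exact absurd rfl hv
  | @cons _ w _ h q =>
    refine ⟨w, h, ?_⟩
    have h1 := SimpleGraph.dist_le q
    have h2 := T.isTree.connected.dist_triangle (u := v) (v := w) (w := T.root)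
    rw [SimpleGraph.dist_eq_one_iff_adj.mpr h] at h2
    rw [SimpleGraph.Walk.length_cons] at hp
    omega

/-- Each arc out of `v` extends to a shortest walk from `v` to the root, hence to a path; in a tree
there is only one such path, so the first steps agree. -/
lemma orientation_adj_unique (T : RootedVertexTree V) {v w w' : V}
    (h : T.orientation.Adj v w) (h' : T.orientation.Adj v w') : w = w' := by
  obtain ⟨q, hq⟩ := T.isTree.connected.exists_walk_length_eq_dist w T.root
  obtain ⟨q', hq'⟩ := T.isTree.connected.exists_walk_length_eq_dist w' T.root
  have h1 := (SimpleGraph.Walk.cons h.1 q).isPath_of_length_eq_dist (by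
    rw [SimpleGraph.Walk.length_cons, hq, h.2])
  have h2 := (SimpleGraph.Walk.cons h'.1 q').isPath_of_length_eq_dist (by
    rw [SimpleGraph.Walk.length_cons, hq', h'.2])
  have h3 := (T.isTree.isAcyclic.subsingleton_path _ _).elim ⟨_, h1⟩ ⟨_, h2⟩
  simp only [Subtype.mk.injEq, SimpleGraph.Walk.cons.injEq] at h3
  exact h3.1

lemma not_orientation_adj_root (T : RootedVertexTree V) (w : V) :
    ¬ T.orientation.Adj T.root w := by
  rintro ⟨-, h⟩
  rw [SimpleGraph.dist_self] at h
  omega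

open Classical in
/-- The parent of a vertex; the root is its own parent. -/
def parent (T : RootedVertexTree V) (v : V) : V :=
  if h : v = T.root then v else (T.exists_orientation_adj h).choose

@[simp] lemma parent_root (T : RootedVertexTree V) : T.parent T.root = T.root := by
  simp [parent]

lemma orientation_adj_iff (T : RootedVertexTree V) {v w : V} :
    T.orientation.Adj v w ↔ v ≠ T.root ∧ T.parent v = w := by
  constructor
  · intro h
    have hv : v ≠ T.root := by
      rintro rfl
      exact T.not_orientation_adj_root _ h
    refine ⟨hv, ?_⟩
    rw [parent, dif_neg hv]
    exact T.orientation_adj_unique (T.exists_orientation_adj hv).choose_spec h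
  · rintro ⟨hv, rfl⟩
    rw [parent, dif_neg hv]
    exact (T.exists_orientation_adj hv).choose_spec

lemma absorbing_parent (T : RootedVertexTree V) : Absorbing T.root T.parent := by
  intro v
  induction hn : T.graph.dist v T.root generalizing v with
  | zero => exact ⟨0, T.isTree.connected.dist_eq_zero_iff.mp hn⟩
  | succ n ih =>
    have hv : v ≠ T.root := by
      rintro rfl
      rw [SimpleGraph.dist_self] at hn
      omega
    have h := T.orientation_adj_iff.mpr ⟨hv, rfl⟩
    obtain ⟨k, hk⟩ := ih (T.parent v) (by have := h.2; omega)
    exact ⟨k + 1, by rwa [Function.iterate_succ_apply]⟩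

lemma graph_adj_iff (T : RootedVertexTree V) {v w : V} :
    T.graph.Adj v w ↔ T.orientation.Adj v w ∨ T.orientation.Adj w v := by
  constructor
  · intro h
    have := T.isTree.dist_eq_dist_add_one_of_adj T.root h
    rw [SimpleGraph.dist_comm (u := T.root), SimpleGraph.dist_comm (u := T.root) (v := w)] at this
    rcases this with h1 | h1
    · exact Or.inl ⟨h, h1⟩
    · exact Or.inr ⟨h.symm, h1⟩
  · rintro (h | h)
    · exact h.1
    · exact h.1.symm

lemma eq_of_parent_eq {S T : RootedVertexTree V} (hr : S.root = T.root)
    (hp : S.parent = T.parent) : S = T := by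
  refine RootedVertexTree.ext ?_ hr
  ext v w
  simp only [graph_adj_iff, orientation_adj_iff, hr, hp]

/-! ### The rooted tree of a parent function -/

/-- The graph in which every vertex is joined to its image under `f`. -/
def parentGraph (f : V → V) : SimpleGraph V := SimpleGraph.fromRel fun v w => f v = w

section

variable {r : V} {f : V → V}

lemma parentGraph_adj_iff (h : Absorbing r f) (hr : f r = r) {v w : V} :
    (parentGraph f).Adj v w ↔ (v ≠ r ∧ f v = w) ∨ (w ≠ r ∧ f w = v) := by
  rw [parentGraph, SimpleGraph.fromRel_adj]
  constructor
  · rintro ⟨hne, h1 | h1⟩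
    · exact Or.inl ⟨by rintro rfl; exact hne (hr.symm.trans h1), h1⟩
    · exact Or.inr ⟨by rintro rfl; exact hne (h1.symm.trans hr), h1⟩
  · rintro (⟨h1, rfl⟩ | ⟨h1, rfl⟩)
    · exact ⟨(h.apply_ne h1).symm, Or.inl rfl⟩
    · exact ⟨h.apply_ne h1, Or.inr rfl⟩

lemma exists_parentGraph_walk (h : Absorbing r f) (hr : f r = r) (v : V) :
    ∃ p : (parentGraph f).Walk v r, p.length = h.depth v := by
  induction hn : h.depth v generalizing v with
  | zero =>
    have := h.iterate_depth v
    rw [hn] at this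
    obtain rfl : v = r := this
    exact ⟨.nil, rfl⟩
  | succ n ih =>
    have hv : v ≠ r := by
      rintro rfl
      rw [h.depth_root] at hn
      omega
    obtain ⟨p, hp⟩ := ih (f v) (by have := h.depth_eq_succ hv; omega)
    exact ⟨.cons ((parentGraph_adj_iff h hr).mpr (Or.inl ⟨hv, rfl⟩)) p, by simp [hp]⟩

/-- Depth drops by at most one along an edge. This is the lower bound that identifies depth with
distance to the root. -/
lemma depth_le_length (h : Absorbing r f) (hr : f r = r) {v w : V}
    (p : (parentGraph f).Walk v w) : h.depth v ≤ h.depth w + p.length := by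
  induction p with
  | nil => simp
  | cons hadj p ih =>
    rw [SimpleGraph.Walk.length_cons]
    rcases (parentGraph_adj_iff h hr).mp hadj with ⟨h1, rfl⟩ | ⟨h1, rfl⟩
    · have := h.depth_eq_succ h1
      omega
    · have := h.depth_eq_succ h1
      omega

lemma parentGraph_connected (h : Absorbing r f) (hr : f r = r) : (parentGraph f).Connected := by
  have : Nonempty V := ⟨r⟩
  refine ⟨fun v w => ?_⟩
  exact (exists_parentGraph_walk h hr v).choose.reachable.trans
    (exists_parentGraph_walk h hr w).choose.reachable.symm

lemma parentGraph_dist (h : Absorbing r f) (hr : f r = r) (v : V) :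
    (parentGraph f).dist v r = h.depth v := by
  apply le_antisymm
  · obtain ⟨p, hp⟩ := exists_parentGraph_walk h hr v
    exact hp ▸ SimpleGraph.dist_le p
  · obtain ⟨p, hp⟩ := (parentGraph_connected h hr).exists_walk_length_eq_dist v r
    have := depth_le_length h hr p
    rw [h.depth_root] at this
    omega

/-- A connected graph is a tree once it has few enough edges, and every edge here is `s(v, f v)` for
some `v ≠ r`. -/
lemma parentGraph_isTree [Finite V] (h : Absorbing r f) (hr : f r = r) :
    (parentGraph f).IsTree := by
  have hc := parentGraph_connected h hr
  rw [SimpleGraph.isTree_iff_connected_and_card]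
  refine ⟨hc, le_antisymm ?_ hc.card_vert_le_card_edgeSet_add_one⟩
  have hsub : (parentGraph f).edgeSet ⊆ (fun v => s(v, f v)) '' {v | v ≠ r} := by
    intro e he
    induction e with
    | h v w =>
      rcases (parentGraph_adj_iff h hr (v := v) (w := w)).mp he with ⟨h1, h2⟩ | ⟨h1, h2⟩
      · exact ⟨v, h1, by rw [← h2]⟩
      · exact ⟨w, h1, by rw [← h2, Sym2.eq_swap]⟩
  have h1 : Nat.card (parentGraph f).edgeSet ≤ {v : V | v ≠ r}.ncard :=
    (Set.ncard_le_ncard hsub (Set.toFinite _)).trans (Set.ncard_image_le (Set.toFinite _))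
  have h2 : {v : V | v ≠ r}.ncard + 1 = Nat.card V := by
    rw [← Set.ncard_add_ncard_compl {v : V | v ≠ r}, Set.compl_ofPred]
    simp
  omega

/-- The rooted tree with parent function `f`. -/
def ofParent [Finite V] (h : Absorbing r f) (hr : f r = r) : RootedVertexTree V :=
  ⟨parentGraph f, parentGraph_isTree h hr, r⟩

lemma parent_ofParent [Finite V] (h : Absorbing r f) (hr : f r = r) :
    (ofParent h hr).parent = f := by
  ext v
  by_cases hv : v = r
  · subst hv
    rw [hr]
    exact (ofParent h hr).parent_root
  · refine ((ofParent h hr).orientation_adj_iff.mp ⟨?_, ?_⟩).2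
    · exact (parentGraph_adj_iff h hr).mpr (Or.inl ⟨hv, rfl⟩)
    · change (parentGraph f).dist v r = (parentGraph f).dist (f v) r + 1
      rw [parentGraph_dist h hr, parentGraph_dist h hr, h.depth_eq_succ hv]

end

end RootedVertexTree

/-! ### Identifying two points of a map: the swap argument. -/

section Fate

variable {V : Type*}

/-- Some iterate of `f` maps `w` to `z`. -/
def Reaches (f : V → V) (w z : V) : Prop := ∃ k, f^[k] w = z

lemma Reaches.refl (f : V → V) (w : V) : Reaches f w w := ⟨0, rfl⟩

lemma Reaches.trans {f : V → V} {x y z : V} (h : Reaches f x y) (h' : Reaches f y z) :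
    Reaches f x z := by
  obtain ⟨k, rfl⟩ := h
  obtain ⟨l, rfl⟩ := h'
  exact ⟨l + k, Function.iterate_add_apply f l k x⟩

lemma Reaches.step {f : V → V} {x z : V} (h : Reaches f (f x) z) : Reaches f x z :=
  Reaches.trans ⟨1, rfl⟩ h

lemma Reaches.eq_of_fixed {f : V → V} {x z : V} (h : Reaches f x z) (hx : f x = x) : z = x := by
  obtain ⟨k, rfl⟩ := h
  exact Function.iterate_fixed hx k

lemma Reaches.unique_of_fixed {f : V → V} {w x y : V} (hx : Reaches f w x) (hy : Reaches f w y)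
    (fx : f x = x) (fy : f y = y) : x = y := by
  obtain ⟨k, rfl⟩ := hx
  obtain ⟨l, rfl⟩ := hy
  have h1 : f^[l + k] w = f^[k] w := by
    rw [Function.iterate_add_apply, Function.iterate_fixed fx]
  have h2 : f^[k + l] w = f^[l] w := by
    rw [Function.iterate_add_apply, Function.iterate_fixed fy]
  rw [← h1, ← h2, add_comm]

/-- If `P` is closed under taking preimages, and holds at `z`, then it holds at every point
that reaches `z`. -/
lemma Reaches.induction {f : V → V} {w z : V} (h : Reaches f w z) (P : V → Prop) (hz : P z)
    (hs : ∀ x, P (f x) → P x) : P w := by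
  obtain ⟨k, hk⟩ := h
  induction k generalizing w with
  | zero =>
    obtain rfl : w = z := hk
    exact hz
  | succ k ih => exact hs _ (ih hk)

lemma Absorbing.not_reaches_of_ne {r : V} {f : V → V} (h : Absorbing r f) (hr : f r = r) {v : V}
    (hv : v ≠ r) : ¬ Reaches f (f v) v := by
  rintro ⟨k, hk⟩
  exact hv (h.eq_of_periodic hr hk)

variable [DecidableEq V]

/-- The map `h` modified so as to fix `u` and `v`. -/
def stopAt (u v : V) (h : V → V) : V → V := fun w => if w = u ∨ w = v then w else h w

/-- The map identifying `u` with `v`. -/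
def mergeInto (u v : V) : V → V := fun w => if w = u then v else w

lemma stopAt_of_ne {u v w : V} (h : V → V) (hu : w ≠ u) (hv : w ≠ v) : stopAt u v h w = h w := by
  simp [stopAt, hu, hv]

/-- Stopping at `u` and `v` forgets their images, the only values the swap alters. Hence the fate of
every point is unaffected by the swap. -/
lemma stopAt_comp_swap (u v : V) (h : V → V) :
    stopAt u v (h ∘ Equiv.swap u v) = stopAt u v h := by
  ext w
  by_cases hw : w = u ∨ w = v
  · simp [stopAt, hw]
  · push Not at hw
    rw [stopAt_of_ne _ hw.1 hw.2, stopAt_of_ne _ hw.1 hw.2, Function.comp_apply,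
      Equiv.swap_apply_of_ne_of_ne hw.1 hw.2]

/-- Every point ends in one of `r`, `u`, `v` when `u` and `v` are made absorbing. -/
def Trichotomous (r u v : V) (h : V → V) : Prop :=
  ∀ w, Reaches (stopAt u v h) w r ∨ Reaches (stopAt u v h) w u ∨ Reaches (stopAt u v h) w v

variable {r u v : V} {h : V → V}

lemma stopAt_left : stopAt u v h u = u := by simp [stopAt]

lemma stopAt_right : stopAt u v h v = v := by simp [stopAt]

lemma reaches_of_reaches_stopAt {w z : V} (hz : Reaches (stopAt u v h) w z) : Reaches h w z := by
  refine hz.induction (fun x => Reaches h x z) (Reaches.refl _ _) fun x hx => ?_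
  by_cases hxu : x = u ∨ x = v
  · simpa [stopAt, hxu] using hx
  · push Not at hxu
    rw [stopAt_of_ne _ hxu.1 hxu.2] at hx
    exact hx.step

lemma reaches_stopAt_of_ne {w z : V} (hu : w ≠ u) (hv : w ≠ v)
    (hw : Reaches (stopAt u v h) (h w) z) : Reaches (stopAt u v h) w z := by
  rw [← stopAt_of_ne h hu hv] at hw
  exact hw.step

lemma trichotomous_of_absorbing (hA : Absorbing r h) : Trichotomous r u v h := by
  intro w
  refine Reaches.induction (hA w) (fun w => Reaches (stopAt u v h) w r ∨
    Reaches (stopAt u v h) w u ∨ Reaches (stopAt u v h) w v) (Or.inl (Reaches.refl _ _)) fun x hx => ?_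
  by_cases hxu : x = u
  · exact Or.inr (Or.inl (hxu ▸ Reaches.refl _ _))
  by_cases hxv : x = v
  · exact Or.inr (Or.inr (hxv ▸ Reaches.refl _ _))
  exact hx.imp (reaches_stopAt_of_ne hxu hxv)
    (Or.imp (reaches_stopAt_of_ne hxu hxv) (reaches_stopAt_of_ne hxu hxv))

/-- With `u` and `v` made absorbing, only the ends of `h u` and `h v` remain to be examined. Of the
nine pairs of ends, `(r, r)`, `(r, u)` and `(v, r)` are those that create no cycle through `u` or
`v`. -/
lemma absorbing_iff_fate (hr : h r = r) (hur : u ≠ r) (hvr : v ≠ r) :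
    Absorbing r h ↔ Trichotomous r u v h ∧
      ((Reaches (stopAt u v h) (h u) r ∧ Reaches (stopAt u v h) (h v) r) ∨
       (Reaches (stopAt u v h) (h u) r ∧ Reaches (stopAt u v h) (h v) u) ∨
       (Reaches (stopAt u v h) (h u) v ∧ Reaches (stopAt u v h) (h v) r)) := by
  constructor
  · intro hA
    have ht := trichotomous_of_absorbing (u := u) (v := v) hA
    refine ⟨ht, ?_⟩
    have nu : ¬ Reaches (stopAt u v h) (h u) u := fun h1 =>
      hA.not_reaches_of_ne hr hur (reaches_of_reaches_stopAt h1)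
    have nv : ¬ Reaches (stopAt u v h) (h v) v := fun h1 =>
      hA.not_reaches_of_ne hr hvr (reaches_of_reaches_stopAt h1)
    have nuv : ¬ (Reaches (stopAt u v h) (h u) v ∧ Reaches (stopAt u v h) (h v) u) :=
      fun ⟨h1, h2⟩ => hA.not_reaches_of_ne hr hur
        ((reaches_of_reaches_stopAt h1).trans (reaches_of_reaches_stopAt h2).step)
    have h1 := ht (h u)
    have h2 := ht (h v)
    tauto
  · rintro ⟨ht, hc⟩
    have key : Reaches h u r ∧ Reaches h v r := by
      rcases hc with ⟨h1, h2⟩ | ⟨h1, h2⟩ | ⟨h1, h2⟩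
      · exact ⟨(reaches_of_reaches_stopAt h1).step, (reaches_of_reaches_stopAt h2).step⟩
      · have h3 := (reaches_of_reaches_stopAt h1).step
        exact ⟨h3, ((reaches_of_reaches_stopAt h2).trans h3).step⟩
      · have h3 := (reaches_of_reaches_stopAt h2).step
        exact ⟨((reaches_of_reaches_stopAt h1).trans h3).step, h3⟩
    intro w
    rcases ht w with h1 | h1 | h1
    · exact reaches_of_reaches_stopAt h1
    · exact (reaches_of_reaches_stopAt h1).trans key.1
    · exact (reaches_of_reaches_stopAt h1).trans key.2

/-- A stopped orbit ending at `z ≠ u` never enters `u`, so the redirection from `u` to `v` does not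
affect it. -/
lemma reaches_merge_of_reaches_stopAt {w z : V} (hzu : z ≠ u)
    (hz : Reaches (stopAt u v h) w z) : Reaches (mergeInto u v ∘ h) w z := by
  have aux : Reaches (stopAt u v h) w z ∧ Reaches (mergeInto u v ∘ h) w z := by
    refine hz.induction (fun x => Reaches (stopAt u v h) x z ∧ Reaches (mergeInto u v ∘ h) x z)
      ⟨Reaches.refl _ _, Reaches.refl _ _⟩ fun x ⟨h1, h2⟩ => ⟨h1.step, ?_⟩
    by_cases hxu : x = u ∨ x = v
    · simpa [stopAt, hxu] using h2
    · push Not at hxu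
      rw [stopAt_of_ne _ hxu.1 hxu.2] at h1 h2
      have hne : h x ≠ u := fun he => hzu ((he ▸ h1).eq_of_fixed stopAt_left)
      apply Reaches.step
      rwa [Function.comp_apply, mergeInto, if_neg hne]
  exact aux.2

/-- After merging nothing maps to `u`, so a cycle can only pass through `v`. The good pairs of ends
of `h u` and `h v` are now `(r, r)`, `(u, r)`, `(v, r)`: compared with `absorbing_iff_fate`, `(r,
u)` is replaced by `(u, r)`. -/
lemma absorbing_merge_iff_fate (hr : h r = r) (huv : u ≠ v) (hur : u ≠ r) (hvr : v ≠ r) :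
    Absorbing r (mergeInto u v ∘ h) ↔
      Trichotomous r u v h ∧ Reaches (stopAt u v h) (h v) r := by
  have hr' : (mergeInto u v ∘ h) r = r := by
    rw [Function.comp_apply, hr, mergeInto, if_neg hur.symm]
  constructor
  · intro hB
    have ht : Trichotomous r u v h := by
      intro w
      refine Reaches.induction (hB w) (fun w => Reaches (stopAt u v h) w r ∨
    Reaches (stopAt u v h) w u ∨ Reaches (stopAt u v h) w v) (Or.inl (Reaches.refl _ _))
        fun x hx => ?_
      by_cases hxu : x = u
      · exact Or.inr (Or.inl (hxu ▸ Reaches.refl _ _))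
      by_cases hxv : x = v
      · exact Or.inr (Or.inr (hxv ▸ Reaches.refl _ _))
      by_cases hhx : h x = u
      · exact Or.inr (Or.inl (reaches_stopAt_of_ne hxu hxv (hhx ▸ Reaches.refl _ _)))
      rw [Function.comp_apply, mergeInto, if_neg hhx] at hx
      exact hx.imp (reaches_stopAt_of_ne hxu hxv)
        (Or.imp (reaches_stopAt_of_ne hxu hxv) (reaches_stopAt_of_ne hxu hxv))
    refine ⟨ht, ?_⟩
    have hn := hB.not_reaches_of_ne hr' hvr
    have hne : h v ≠ u := by
      intro he
      apply hn
      rw [Function.comp_apply, mergeInto, if_pos he]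
      exact Reaches.refl _ _
    rw [Function.comp_apply, mergeInto, if_neg hne] at hn
    rcases ht (h v) with h1 | h1 | h1
    · exact h1
    · exfalso
      apply hn
      -- The stopped orbit ends at `u`, but the merged map diverts its last step to `v`. The guard
      -- `x ≠ u` excludes the endpoint itself, for which the claim may fail.
      refine (h1.induction (fun x => x ≠ u → Reaches (mergeInto u v ∘ h) x v)
        (fun h => absurd rfl h) fun x hx hxu => ?_) hne
      by_cases hxv : x = v
      · rw [hxv]
        exact Reaches.refl _ _
      rw [stopAt_of_ne _ hxu hxv] at hx
      by_cases hhx : h x = u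
      · exact ⟨1, by simp [mergeInto, hhx]⟩
      · apply Reaches.step
        rw [Function.comp_apply, mergeInto, if_neg hhx]
        exact hx hhx
    · exact absurd (reaches_merge_of_reaches_stopAt huv.symm h1) hn
  · rintro ⟨ht, hb⟩
    have hv : Reaches (mergeInto u v ∘ h) v r := by
      have hne : h v ≠ u := fun he => hur ((he ▸ hb).eq_of_fixed stopAt_left).symm
      apply Reaches.step
      rw [Function.comp_apply, mergeInto, if_neg hne]
      exact reaches_merge_of_reaches_stopAt hur.symm hb
    have hne : ∀ x, x ≠ u → Reaches (mergeInto u v ∘ h) x r := by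
      intro x hxu
      rcases ht x with h1 | h1 | h1
      · exact reaches_merge_of_reaches_stopAt hur.symm h1
      · refine h1.induction (fun x => x ≠ u → Reaches (mergeInto u v ∘ h) x r)
          (fun h => absurd rfl h) (fun x hx hxu => ?_) hxu
        by_cases hxv : x = v
        · rwa [hxv]
        rw [stopAt_of_ne _ hxu hxv] at hx
        apply Reaches.step
        by_cases hhx : h x = u
        · rwa [Function.comp_apply, mergeInto, if_pos hhx]
        · rw [Function.comp_apply, mergeInto, if_neg hhx]
          exact hx hhx
      · exact (reaches_merge_of_reaches_stopAt huv.symm h1).trans hv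
    intro w
    refine Reaches.step (hne _ ?_)
    rw [Function.comp_apply, mergeInto]
    split_ifs with hw
    · exact huv.symm
    · exact hw

lemma stopAt_root (hr : h r = r) : stopAt u v h r = r := by
  simp [stopAt, hr]

/-- Exchanging the images of `u` and `v` interchanges the maps for which exactly one of `h` and
its quotient by `u ∼ v` is absorbing. -/
lemma absorbing_comp_swap_iff (hr : h r = r) (huv : u ≠ v) (hur : u ≠ r) (hvr : v ≠ r)
    (hx : ¬ (Absorbing r h ↔ Absorbing r (mergeInto u v ∘ h))) :
    (Absorbing r (h ∘ Equiv.swap u v) ↔ Absorbing r (mergeInto u v ∘ h)) ∧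
    (Absorbing r (mergeInto u v ∘ (h ∘ Equiv.swap u v)) ↔ Absorbing r h) := by
  have hr' : (h ∘ Equiv.swap u v) r = r := by
    rw [Function.comp_apply, Equiv.swap_apply_of_ne_of_ne hur.symm hvr.symm, hr]
  rw [absorbing_iff_fate hr hur hvr, absorbing_merge_iff_fate hr huv hur hvr] at *
  rw [absorbing_iff_fate hr' hur hvr, absorbing_merge_iff_fate hr' huv hur hvr]
  unfold Trichotomous at *
  rw [stopAt_comp_swap]
  simp only [Function.comp_apply, Equiv.swap_apply_left, Equiv.swap_apply_right]
  have e1 : ∀ w, ¬ (Reaches (stopAt u v h) w r ∧ Reaches (stopAt u v h) w u) := fun w h1 =>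
    hur (h1.1.unique_of_fixed h1.2 (stopAt_root hr) stopAt_left).symm
  have e2 : ∀ w, ¬ (Reaches (stopAt u v h) w r ∧ Reaches (stopAt u v h) w v) := fun w h1 =>
    hvr (h1.1.unique_of_fixed h1.2 (stopAt_root hr) stopAt_right).symm
  have e3 : ∀ w, ¬ (Reaches (stopAt u v h) w u ∧ Reaches (stopAt u v h) w v) := fun w h1 =>
    huv (h1.1.unique_of_fixed h1.2 stopAt_left stopAt_right)
  have a1 := e1 (h u)
  have a2 := e2 (h u)
  have a3 := e3 (h u)
  have b1 := e1 (h v)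
  have b2 := e2 (h v)
  have b3 := e3 (h v)
  by_cases ht : ∀ w, Reaches (stopAt u v h) w r ∨ Reaches (stopAt u v h) w u ∨
      Reaches (stopAt u v h) w v
  · have c1 := ht (h u)
    have c2 := ht (h v)
    simp only [ht, implies_true, true_and] at hx ⊢
    clear ht e1 e2 e3
    generalize Reaches (stopAt u v h) (h u) r = p1 at *
    generalize Reaches (stopAt u v h) (h u) u = p2 at *
    generalize Reaches (stopAt u v h) (h u) v = p3 at *
    generalize Reaches (stopAt u v h) (h v) r = q1 at *
    generalize Reaches (stopAt u v h) (h v) u = q2 at *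
    generalize Reaches (stopAt u v h) (h v) v = q3 at *
    -- The ends of `h u` and `h v` are each exactly one of `r`, `u`, `v`. The two criteria differ
    -- only on `(r, u)` and `(u, r)`, which the swap interchanges.
    by_cases p1 <;> by_cases p2 <;> by_cases p3 <;> by_cases q1 <;> by_cases q2 <;>
      by_cases q3 <;> simp_all
  · simp only [ht, false_and, not_true] at hx

end Fate

/-! ### Collapsing each class to a representative. -/

section Merge

variable {V C : Type*} [Fintype V] [DecidableEq V]

open Classical in
/-- The number of permutations `g` with `κ ∘ g = κ` for which `h ∘ g` is absorbing does not change
when two points of the same class are identified. -/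
lemma card_absorbing_merge (κ : V → C) {r u v : V} (h : V → V)
    (hκ : κ u = κ v) (hκr : ∀ w, κ w = κ r → w = r) (hr : h r = r)
    (huv : u ≠ v) (hur : u ≠ r) (hvr : v ≠ r) :
    Fintype.card {g : Equiv.Perm V // κ ∘ g = κ ∧ Absorbing r (h ∘ g)} =
      Fintype.card {g : Equiv.Perm V // κ ∘ g = κ ∧ Absorbing r (mergeInto u v ∘ h ∘ g)} := by
  have hg : ∀ g : Equiv.Perm V, κ ∘ g = κ → (h ∘ g) r = r := fun g hg => by
    rw [Function.comp_apply, hκr (g r) (congrFun hg r), hr]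
  have hsw : ∀ g : Equiv.Perm V, κ ∘ g = κ →
      κ ∘ (g * Equiv.swap u v : Equiv.Perm V) = κ := fun g hg => by
    ext w
    change κ (g (Equiv.swap u v w)) = κ w
    rw [show κ (g (Equiv.swap u v w)) = κ (Equiv.swap u v w) from congrFun hg _,
      Equiv.swap_apply_def]
    split_ifs with h1 h2
    · rw [h1, hκ]
    · rw [h2, hκ]
    · rfl
  have key : ∀ g : Equiv.Perm V, κ ∘ g = κ →
      ¬ (Absorbing r (h ∘ g) ↔ Absorbing r (mergeInto u v ∘ h ∘ g)) →
      (Absorbing r (h ∘ (g * Equiv.swap u v : Equiv.Perm V)) ↔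
        Absorbing r (mergeInto u v ∘ h ∘ g)) ∧
      (Absorbing r (mergeInto u v ∘ h ∘ (g * Equiv.swap u v : Equiv.Perm V)) ↔
        Absorbing r (h ∘ g)) := fun g h1 h2 =>
    absorbing_comp_swap_iff (hg g h1) huv hur hvr h2
  -- `F` leaves `g` alone when both maps agree on being absorbing and otherwise applies the swap; it
  -- is an involution carrying one set of permutations to the other.
  let F : Equiv.Perm V → Equiv.Perm V := fun g =>
    if (Absorbing r (h ∘ g) ↔ Absorbing r (mergeInto u v ∘ h ∘ g)) then g
    else g * Equiv.swap u v
  have hF : ∀ g : Equiv.Perm V, κ ∘ g = κ → κ ∘ F g = κ ∧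
      (Absorbing r (h ∘ F g) ↔ Absorbing r (mergeInto u v ∘ h ∘ g)) ∧
      (Absorbing r (mergeInto u v ∘ h ∘ F g) ↔ Absorbing r (h ∘ g)) ∧ F (F g) = g := by
    intro g h1
    by_cases hx : Absorbing r (h ∘ g) ↔ Absorbing r (mergeInto u v ∘ h ∘ g)
    · have : F g = g := if_pos hx
      simp only [this]
      exact ⟨h1, hx, hx.symm, trivial⟩
    · have h2 : F g = g * Equiv.swap u v := if_neg hx
      obtain ⟨k1, k2⟩ := key g h1 hx
      rw [h2]
      refine ⟨hsw g h1, k1, k2, ?_⟩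
      have hx' : ¬ (Absorbing r (h ∘ (g * Equiv.swap u v : Equiv.Perm V)) ↔
          Absorbing r (mergeInto u v ∘ h ∘ (g * Equiv.swap u v : Equiv.Perm V))) := by
        rw [k1, k2]
        exact fun h => hx h.symm
      simp only [F, if_neg hx', mul_assoc, Equiv.swap_mul_self, mul_one]
  refine Fintype.card_congr ⟨fun g => ⟨F g, ?_⟩, fun g => ⟨F g, ?_⟩, fun g => ?_, fun g => ?_⟩
  · exact ⟨(hF g g.2.1).1, (hF g g.2.1).2.2.1.mpr g.2.2⟩
  · exact ⟨(hF g g.2.1).1, (hF g g.2.1).2.1.mpr g.2.2⟩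
  · exact Subtype.ext (hF g g.2.1).2.2.2
  · exact Subtype.ext (hF g g.2.1).2.2.2

open Classical in
/-- The number of permutations `g` with `κ ∘ g = κ` for which `f ∘ g` is absorbing is the number of
those for which the map induced by `f ∘ g` on one representative of each class is absorbing. -/
lemma card_absorbing_eq_quotient (κ : V → C) (ℓ : C → V) (hℓ : ∀ x, κ (ℓ x) = x) {r : V}
    (f : V → V) (hκr : ∀ w, κ w = κ r → w = r) (hr : f r = r) :
    Fintype.card {g : Equiv.Perm V // κ ∘ g = κ ∧ Absorbing r (f ∘ g)} =
      Fintype.card {g : Equiv.Perm V //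
        κ ∘ g = κ ∧ Absorbing (κ r) (κ ∘ f ∘ g ∘ ℓ)} := by
  -- The points outside the image of `ℓ` are merged into their representatives one at a time; `W` is
  -- the set already merged.
  have step : ∀ W : Finset V, (∀ w ∈ W, ℓ (κ w) ≠ w) →
      Fintype.card {g : Equiv.Perm V // κ ∘ g = κ ∧ Absorbing r (f ∘ g)} =
      Fintype.card {g : Equiv.Perm V // κ ∘ g = κ ∧
        Absorbing r ((fun w => if w ∈ W then ℓ (κ w) else w) ∘ f ∘ g)} := by
    intro W
    induction W using Finset.induction_on with
    | empty => intro _; simp only [Finset.notMem_empty, if_false]; rfl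
    | insert u W hu ih =>
      intro hW
      rw [ih fun w hw => hW w (Finset.mem_insert_of_mem hw)]
      have hℓr : ℓ (κ r) = r := hκr _ (hℓ _)
      have huℓ := hW u (Finset.mem_insert_self _ _)
      have hur : u ≠ r := by
        rintro rfl
        exact huℓ hℓr
      have hrW : r ∉ W := fun h => hW r (Finset.mem_insert_of_mem h) hℓr
      have := card_absorbing_merge κ (r := r) (u := u) (v := ℓ (κ u))
        ((fun w => if w ∈ W then ℓ (κ w) else w) ∘ f) (hℓ _).symm hκr
        (by simp [hr, hrW]) huℓ.symm hur (by
          intro h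
          apply hur
          apply hκr
          rw [← h, hℓ])
      have e : (fun w => if w ∈ insert u W then ℓ (κ w) else w) =
          mergeInto u (ℓ (κ u)) ∘ fun w => if w ∈ W then ℓ (κ w) else w := by
        ext w
        simp only [Function.comp_apply, mergeInto, Finset.mem_insert]
        by_cases hwu : w = u
        · subst hwu
          simp [hu]
        by_cases hwW : w ∈ W
        · have : ℓ (κ w) ≠ u := by
            rintro h
            apply huℓ
            rw [← h, hℓ]
          simp [hwW, this]
        · simp [hwW, hwu]
      rw [e]
      exact this
  rw [step {w | ℓ (κ w) ≠ w} (by simp)]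
  have e : (fun w => if w ∈ ({w | ℓ (κ w) ≠ w} : Finset V) then ℓ (κ w) else w) = ℓ ∘ κ := by
    ext w
    by_cases hw : ℓ (κ w) = w <;> simp [hw]
  rw [e]
  have hℓr : ℓ (κ r) = r := hκr _ (hℓ _)
  refine Fintype.card_congr (Equiv.subtypeEquivRight fun g => and_congr_right fun _ => ?_)
  have semi : Function.Semiconj ℓ (κ ∘ f ∘ g ∘ ℓ) ((ℓ ∘ κ) ∘ f ∘ g) := fun _ => rfl
  constructor
  · intro h x
    obtain ⟨k, hk⟩ := h (ℓ x)
    refine ⟨k, ?_⟩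
    rw [← (semi.iterate_right k) x] at hk
    rw [← hk, hℓ]
  · intro h w
    -- One application of the collapsed map lands on a representative, and from there the orbit
    -- follows the quotient map; hence `k + 1` steps.
    obtain ⟨k, hk⟩ := h (κ (f (g w)))
    refine ⟨k + 1, ?_⟩
    rw [Function.iterate_succ_apply]
    exact ((semi.iterate_right k) _).symm.trans (hk ▸ hℓr)

end Merge

/-! ### Counting permutations and maps with prescribed fibers. -/

section PermCount

/-- Composing with a swap of values shows that all images of `a` are equally frequent among the
permutations. -/
lemma card_perm_apply_eq {X : Type*} [Finite X] (a b : X) :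
    Nat.card {σ : Equiv.Perm X // σ a = b} = (Nat.card X - 1)! := by
  classical
  have := Fintype.ofFinite X
  have h : ∀ c, Nat.card {σ : Equiv.Perm X // σ a = c} =
      Nat.card {σ : Equiv.Perm X // σ a = b} := by
    intro c
    refine Nat.card_congr ((Equiv.mulLeft (Equiv.swap c b)).subtypeEquiv fun σ => ?_)
    change σ a = c ↔ Equiv.swap c b (σ a) = b
    constructor
    · intro h
      rw [h, Equiv.swap_apply_left]
    · intro h
      exact (Equiv.swap c b).injective (h.trans (Equiv.swap_apply_left c b).symm)
  have h2 : Nat.card (Equiv.Perm X) = Nat.card X * Nat.card {σ : Equiv.Perm X // σ a = b} := by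
    rw [← Nat.card_congr (Equiv.sigmaFiberEquiv fun σ : Equiv.Perm X => σ a), Nat.card_sigma,
      Finset.sum_congr rfl fun c _ => h c, Finset.sum_const, Finset.card_univ, smul_eq_mul,
      ← Nat.card_eq_fintype_card]
  have : Nonempty X := ⟨a⟩
  have hpos : 0 < Nat.card X := Nat.card_pos
  rw [Nat.card_perm, ← Nat.mul_factorial_pred hpos.ne'] at h2
  exact (Nat.eq_of_mul_eq_mul_left hpos h2).symm

lemma card_perm_apply {X : Type*} [Finite X] (a : X) (Q : X → Prop) :
    Nat.card {σ : Equiv.Perm X // Q (σ a)} = (Nat.card X - 1)! * Nat.card {b : X // Q b} := by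
  classical
  have := Fintype.ofFinite X
  have e : {σ : Equiv.Perm X // Q (σ a)} ≃ Σ b : {b : X // Q b}, {σ : Equiv.Perm X // σ a = b} :=
    ⟨fun σ => ⟨⟨σ.1 a, σ.2⟩, σ.1, rfl⟩, fun p => ⟨p.2.1, p.2.2.symm ▸ p.1.2⟩, fun _ => rfl, by
      rintro ⟨⟨b, hb⟩, σ, h⟩
      obtain rfl : σ a = b := h
      rfl⟩
  rw [Nat.card_congr e, Nat.card_sigma, Finset.sum_congr rfl fun b _ => card_perm_apply_eq a b.1,
    Finset.sum_const, Finset.card_univ, smul_eq_mul, Nat.card_eq_fintype_card (α := {b // Q b}),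
    mul_comm]

variable {V C : Type*}

/-- The permutations preserving each fiber of `κ` are the families of permutations of the
fibers. -/
def permFiberEquiv (κ : V → C) :
    {g : Equiv.Perm V // κ ∘ g = κ} ≃ ∀ x, Equiv.Perm {v // κ v = x} :=
  ((DomMulAct.mk.subtypeEquiv fun _ => Iff.rfl).trans MulOpposite.opEquiv).trans
    (DomMulAct.stabilizerMulEquiv κ).toEquiv

lemma permFiberEquiv_apply (κ : V → C) (g : {g : Equiv.Perm V // κ ∘ g = κ}) (x : C)
    (v : {v // κ v = x}) : (permFiberEquiv κ g x v : V) = g.1 v := rfl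

/-- The number of permutations preserving each fiber of `κ` and sending the representative of
each fiber to a prescribed subset. -/
lemma card_perm_fiber [Finite V] [Fintype C] (κ : V → C) (ℓ : C → V) (hℓ : ∀ x, κ (ℓ x) = x)
    (Q : C → V → Prop) :
    Nat.card {g : Equiv.Perm V // κ ∘ g = κ ∧ ∀ x, Q x (g (ℓ x))} =
      ∏ x, ((Nat.card {v // κ v = x} - 1)! * Nat.card {v // κ v = x ∧ Q x v}) := by
  have e : {g : Equiv.Perm V // κ ∘ g = κ ∧ ∀ x, Q x (g (ℓ x))} ≃
      ∀ x, {σ : Equiv.Perm {v // κ v = x} // Q x (σ ⟨ℓ x, hℓ x⟩)} :=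
    (Equiv.subtypeSubtypeEquivSubtypeInter (fun g : Equiv.Perm V => κ ∘ g = κ)
      fun g => ∀ x, Q x (g (ℓ x))).symm.trans
    (((permFiberEquiv κ).subtypeEquiv fun g => by
      simp only [permFiberEquiv_apply]).trans Equiv.subtypePiEquivPi)
  rw [Nat.card_congr e, Nat.card_pi]
  refine Finset.prod_congr rfl fun x _ => ?_
  rw [card_perm_apply (⟨ℓ x, hℓ x⟩ : {v // κ v = x}) fun v => Q x v]
  congr 1
  exact Nat.card_congr (Equiv.subtypeSubtypeEquivSubtypeInter (fun v => κ v = x) (Q x))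

variable {I : Type*}

/-- `f` and `f₀` take each value equally often on each fiber of `κ`. -/
def SameFiberCount (κ : V → C) (f₀ f : V → I) : Prop :=
  ∀ x i, Nat.card {v // κ v = x ∧ f v = i} = Nat.card {v // κ v = x ∧ f₀ v = i}

/-- The joint fibers of `(κ, f)` and `(κ, f₀)` have equal sizes; bijections between them glue to a
permutation. -/
lemma SameFiberCount.exists_perm [Finite V] {κ : V → C} {f₀ f : V → I}
    (h : SameFiberCount κ f₀ f) : ∃ g : Equiv.Perm V, κ ∘ g = κ ∧ f₀ ∘ g = f := by
  have e : ∀ p : C × I, Nonempty ({v // (κ v, f v) = p} ≃ {v // (κ v, f₀ v) = p}) := fun p => by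
    refine Finite.card_eq.mp ?_
    simp only [Prod.ext_iff]
    exact h p.1 p.2
  replace e := fun p => (e p).some
  have := Equiv.ofFiberEquiv_map e
  exact ⟨Equiv.ofFiberEquiv e, funext fun v => congrArg Prod.fst (this v),
    funext fun v => congrArg Prod.snd (this v)⟩

lemma sameFiberCount_comp {κ : V → C} {f₀ : V → I} {g : Equiv.Perm V} (hg : κ ∘ g = κ) :
    SameFiberCount κ f₀ (f₀ ∘ g) := by
  intro x i
  refine Nat.card_congr (g.subtypeEquiv fun v => ?_)
  rw [show κ (g v) = κ v from congrFun hg v]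
  rfl

open Classical in
/-- Counting functions with prescribed fibers by counting permutations. -/
lemma card_sameFiberCount_mul [Fintype V] (κ : V → C) (f₀ : V → I) (P : (V → I) → Prop) :
    Nat.card {f : V → I // SameFiberCount κ f₀ f ∧ P f} *
      ∏ p ∈ Finset.univ.image (fun v => (κ v, f₀ v)),
        (Nat.card {v // κ v = p.1 ∧ f₀ v = p.2})! =
      Nat.card {g : Equiv.Perm V // κ ∘ g = κ ∧ P (f₀ ∘ g)} := by
  let κ' : V → C × I := fun v => (κ v, f₀ v)
  have hκ' : ∀ g : Equiv.Perm V, κ' ∘ g = κ' ↔ κ ∘ g = κ ∧ f₀ ∘ g = f₀ := fun g => by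
    simp only [funext_iff, κ', Function.comp_apply, Prod.ext_iff, forall_and]
  have hK := DomMulAct.stabilizer_card' κ'
  have hK' : Nat.card {g : Equiv.Perm V // κ' ∘ g = κ'} =
      ∏ p ∈ Finset.univ.image (fun v => (κ v, f₀ v)),
        (Nat.card {v // κ v = p.1 ∧ f₀ v = p.2})! := by
    rw [Nat.card_eq_fintype_card, hK]
    refine Finset.prod_congr rfl fun p _ => ?_
    rw [← Nat.card_eq_fintype_card]
    simp only [κ', Prod.ext_iff]
  rw [← hK', ← Nat.card_prod]
  -- The permutations carrying `f₀` to a given `f` form a coset of the stabilizer of `(κ, f₀)`, so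
  -- all these sets have the same size.
  have e : ∀ f : {f : V → I // SameFiberCount κ f₀ f ∧ P f},
      Nonempty ({g : Equiv.Perm V // κ' ∘ g = κ'} ≃
        {g : {g : Equiv.Perm V // κ ∘ g = κ ∧ P (f₀ ∘ g)} // f₀ ∘ g.1 = f.1}) := by
    rintro ⟨f, hf, hP⟩
    obtain ⟨g₀, h1, h2⟩ := hf.exists_perm
    refine ⟨((Equiv.mulRight g₀).subtypeEquiv (q := fun g : Equiv.Perm V =>
      (κ ∘ g = κ ∧ P (f₀ ∘ g)) ∧ f₀ ∘ g = f) fun g => ?_).trans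
      (Equiv.subtypeSubtypeEquivSubtypeInter (fun g : Equiv.Perm V => κ ∘ g = κ ∧ P (f₀ ∘ g))
        fun g => f₀ ∘ g = f).symm⟩
    rw [hκ']
    have c1 : κ ∘ (g * g₀ : Equiv.Perm V) = κ ↔ κ ∘ g = κ := by
      conv_lhs => rhs; rw [← h1]
      rw [Equiv.Perm.coe_mul, ← Function.comp_assoc]
      exact g₀.surjective.injective_comp_right.eq_iff
    have c2 : f₀ ∘ (g * g₀ : Equiv.Perm V) = f ↔ f₀ ∘ g = f₀ := by
      conv_lhs => rhs; rw [← h2]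
      rw [Equiv.Perm.coe_mul, ← Function.comp_assoc]
      exact g₀.surjective.injective_comp_right.eq_iff
    change _ ↔ (κ ∘ (g * g₀ : Equiv.Perm V) = κ ∧ P (f₀ ∘ (g * g₀ : Equiv.Perm V))) ∧
      f₀ ∘ (g * g₀ : Equiv.Perm V) = f
    rw [c1]
    constructor
    · rintro ⟨a, b⟩
      have := c2.mpr b
      exact ⟨⟨a, this.symm ▸ hP⟩, this⟩
    · rintro ⟨⟨a, -⟩, b⟩
      exact ⟨a, c2.mp b⟩
  replace e := fun p => (e p).some
  have e1 := (Equiv.sigmaFiberEquiv fun g : {g : Equiv.Perm V // κ ∘ g = κ ∧ P (f₀ ∘ g)} =>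
    (⟨f₀ ∘ g.1, sameFiberCount_comp g.2.1, g.2.2⟩ :
      {f : V → I // SameFiberCount κ f₀ f ∧ P f}))
  refine Nat.card_congr (((Equiv.sigmaEquivProd _ _).symm.trans (Equiv.sigmaCongrRight fun f =>
    (e f).trans (Equiv.subtypeEquivRight fun g => ?_))).trans e1)
  rw [Subtype.ext_iff]

/-- A function with prescribed finite fiber sizes exists when the sizes add up. -/
lemma exists_card_fiber_eq {X : Type*} [Finite X] (c : I →₀ ℕ)
    (h : (c.sum fun _ a => a) = Nat.card X) :
    ∃ f : X → I, ∀ i, Nat.card {v // f v = i} = c i := by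
  classical
  have e : X ≃ Σ i : c.support, Fin (c i) := by
    refine (Finite.card_eq.mp ?_).some
    rw [← h, Nat.card_sigma, Finsupp.sum, ← Finset.sum_coe_sort]
    simp
  refine ⟨fun v => (e v).1, fun i => ?_⟩
  by_cases hi : i ∈ c.support
  · have : {v // ((e v).1 : I) = i} ≃ Fin (c i) :=
      (e.subtypeEquiv (q := fun p => p.1 = ⟨i, hi⟩) fun v => by rw [Subtype.ext_iff]).trans
        (Equiv.sigmaSubtype (a := (⟨i, hi⟩ : c.support)))
    rw [Nat.card_congr this, Nat.card_eq_fintype_card, Fintype.card_fin]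
  · rw [Finsupp.notMem_support_iff.mp hi, Nat.card_eq_zero]
    refine Or.inl (isEmpty_subtype _ |>.mpr fun v hv => hi ?_)
    rw [← hv]
    exact (e v).1.2

lemma exists_card_fiber_fiber_eq [Finite V] (κ : V → C) (c : C → I →₀ ℕ)
    (h : ∀ x, ((c x).sum fun _ a => a) = Nat.card {v // κ v = x}) :
    ∃ f : V → I, ∀ x i, Nat.card {v // κ v = x ∧ f v = i} = c x i := by
  have H : ∀ x, ∃ f : {v // κ v = x} → I, ∀ i, Nat.card {v // f v = i} = c x i :=
    fun x => exists_card_fiber_eq (c x) (h x)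
  choose f hf using H
  let g : V → I := fun v => f (κ v) ⟨v, rfl⟩
  refine ⟨g, fun x i => ?_⟩
  rw [← hf]
  refine Nat.card_congr ((Equiv.subtypeSubtypeEquivSubtypeInter (fun v => κ v = x)
    (fun v => g v = i)).symm.trans (Equiv.subtypeEquivRight ?_))
  rintro ⟨v, rfl⟩
  rfl

end PermCount

lemma natCard_subtype_eq_sum {X : Type*} [Fintype X] (p : X → Prop) [DecidablePred p] :
    Nat.card {x // p x} = ∑ x, if p x then 1 else 0 := by
  rw [Nat.card_eq_fintype_card, Fintype.card_subtype, Finset.card_filter]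

/-! ### From permutations to trees on the set of classes. -/

section ParentCount

variable {V C : Type*} [Fintype V] [Fintype C]

open Classical in
-- Sort the `g` by the map `p` they induce on classes. For fixed `p` the condition constrains only
-- the image of each representative, class by class.
lemma card_absorbing_comp_mul (κ : V → C) (ℓ : C → V) (hℓ : ∀ x, κ (ℓ x) = x) (f : V → V) (z : C) :
    Nat.card {g : Equiv.Perm V // κ ∘ g = κ ∧ Absorbing z (κ ∘ f ∘ g ∘ ℓ)} =
      (∏ x, (Nat.card {v // κ v = x} - 1)!) *
        ∑ p : C → C with Absorbing z p, ∏ x, Nat.card {v // κ v = x ∧ κ (f v) = p x} := by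
  have e : {g : Equiv.Perm V // κ ∘ g = κ ∧ Absorbing z (κ ∘ f ∘ g ∘ ℓ)} ≃
      Σ p : {p : C → C // Absorbing z p},
        {g : Equiv.Perm V // κ ∘ g = κ ∧ ∀ x, κ (f (g (ℓ x))) = p.1 x} :=
    ⟨fun g => ⟨⟨_, g.2.2⟩, g.1, g.2.1, fun _ => rfl⟩,
      fun q => ⟨q.2.1, q.2.2.1, by
        have : κ ∘ f ∘ q.2.1 ∘ ℓ = q.1.1 := funext q.2.2.2
        rw [this]
        exact q.1.2⟩, fun _ => rfl, by
      rintro ⟨⟨p, hp⟩, g, hg, h⟩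
      obtain rfl : (fun x => κ (f (g (ℓ x)))) = p := funext h
      rfl⟩
  rw [Nat.card_congr e, Nat.card_sigma, Finset.mul_sum,
    Finset.sum_subtype (p := Absorbing z) (Finset.univ.filter fun p : C → C => Absorbing z p)
      (by simp)]
  refine Finset.sum_congr rfl fun p _ => ?_
  rw [card_perm_fiber κ ℓ hℓ fun x v => κ (f v) = p.1 x, Finset.prod_mul_distrib]

open Classical in
/-- Sums over spanning trees as sums over parent functions. -/
lemma sum_rootedVertexTree (z : C) (w : C → C → ℕ) :
    ∑ A : RootedVertexTree C with A.root = z, ∏ e ∈ A.arcs, w e.1 e.2 =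
      ∑ p : C → C with Absorbing z p ∧ p z = z, ∏ x with x ≠ z, w x (p x) := by
  refine Finset.sum_bij' (fun A _ => A.parent)
    (fun p hp => RootedVertexTree.ofParent (Finset.mem_filter.mp hp).2.1
      (Finset.mem_filter.mp hp).2.2)
    ?_ ?_ ?_ ?_ ?_
  · intro A hA
    obtain rfl := (Finset.mem_filter.mp hA).2
    exact Finset.mem_filter.mpr ⟨Finset.mem_univ _, A.absorbing_parent, A.parent_root⟩
  · intro p hp
    exact Finset.mem_filter.mpr ⟨Finset.mem_univ _, rfl⟩
  · intro A hA
    exact RootedVertexTree.eq_of_parent_eq (Finset.mem_filter.mp hA).2.symm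
      (RootedVertexTree.parent_ofParent _ _)
  · intro p hp
    exact RootedVertexTree.parent_ofParent _ _
  · intro A hA
    obtain rfl := (Finset.mem_filter.mp hA).2
    refine Finset.prod_bij' (fun e _ => e.1) (fun x _ => (x, A.parent x)) ?_ ?_ ?_ ?_ ?_
    · intro e he
      rw [RootedVertexTree.arcs, Finset.mem_filter, RootedVertexTree.orientation_adj_iff] at he
      exact Finset.mem_filter.mpr ⟨Finset.mem_univ _, he.2.1⟩
    · intro x hx
      rw [RootedVertexTree.arcs, Finset.mem_filter, RootedVertexTree.orientation_adj_iff]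
      exact ⟨Finset.mem_univ _, (Finset.mem_filter.mp hx).2, rfl⟩
    · intro e he
      rw [RootedVertexTree.arcs, Finset.mem_filter, RootedVertexTree.orientation_adj_iff] at he
      exact Prod.ext rfl he.2.2
    · intro x hx
      rfl
    · intro e he
      rw [RootedVertexTree.arcs, Finset.mem_filter, RootedVertexTree.orientation_adj_iff] at he
      rw [he.2.2]

open Classical in
/-- The number of rooted trees on `V` in which the number of children of each vertex in each class
is prescribed, as a sum over rooted trees on the set of classes. -/
theorem card_parent_mul (κ : V → C) (ℓ : C → V) (hℓ : ∀ x, κ (ℓ x) = x) {r : V}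
    (hκr : ∀ w, κ w = κ r → w = r) (f : V → V) (hr : f r = r) :
    Nat.card {f' : V → V // SameFiberCount κ f f' ∧ Absorbing r f'} *
        ∏ x, ∏ w, (Nat.card {v // κ v = x ∧ f v = w})! =
      (∏ x, (Nat.card {v // κ v = x} - 1)!) *
        ∑ A : RootedVertexTree C with A.root = κ r, ∏ e ∈ A.arcs,
          Nat.card {v // κ v = e.1 ∧ κ (f v) = e.2} := by
  have h1 := card_sameFiberCount_mul κ f (Absorbing r)
  rw [Finset.prod_subset (Finset.subset_univ _) (fun p _ hp => by
    have : IsEmpty {v // κ v = p.1 ∧ f v = p.2} := by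
      rw [isEmpty_subtype]
      rintro v ⟨h2, h3⟩
      exact hp (Finset.mem_image.mpr ⟨v, Finset.mem_univ _, Prod.ext h2 h3⟩)
    rw [Nat.card_of_isEmpty, Nat.factorial_zero]), Fintype.prod_prod_type] at h1
  rw [h1, Nat.card_eq_fintype_card, card_absorbing_eq_quotient κ ℓ hℓ f hκr hr,
    ← Nat.card_eq_fintype_card, card_absorbing_comp_mul κ ℓ hℓ,
    sum_rootedVertexTree (κ r) fun x y => Nat.card {v // κ v = x ∧ κ (f v) = y}]
  congr 1
  -- The class of `r` is `{r}` and `f` fixes `r`, so its factor is the indicator of `p` fixing `κ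
  -- r`; this restricts the sum to parent maps of rooted trees.
  have hone : ∀ p : C → C, Nat.card {v // κ v = κ r ∧ κ (f v) = p (κ r)} =
      if p (κ r) = κ r then 1 else 0 := by
    intro p
    split_ifs with hp
    · rw [hp, Nat.card_eq_one_iff_unique]
      refine ⟨⟨fun a b => Subtype.ext ((hκr _ a.2.1).trans (hκr _ b.2.1).symm)⟩, ⟨r, rfl, ?_⟩⟩
      rw [hr]
    · have : IsEmpty {v // κ v = κ r ∧ κ (f v) = p (κ r)} := by
        rw [isEmpty_subtype]
        rintro v ⟨h2, h3⟩
        rw [hκr v h2, hr] at h3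
        exact hp h3.symm
      exact Nat.card_of_isEmpty
  rw [← Finset.filter_filter, Finset.sum_filter (fun p : C → C => p (κ r) = κ r)]
  refine Finset.sum_congr rfl fun p _ => ?_
  rw [← Finset.mul_prod_erase _ _ (Finset.mem_univ (κ r)), hone, Finset.filter_ne']
  split_ifs <;> simp

end ParentCount

/-! ### Assignments of complete degree types, and necessity of the conditions. -/

namespace MultitypeCayley

variable {d : ℕ}

/-- `τ` assigns to each vertex of type `t` a pair `(u, c)` such that each complete degree type
`(t, u, c)` occurs `N t u c` times. -/
def IsAssignment (N : CompleteData d)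
    (τ : Vertex (profile N) → Fin (d + 1) × (Fin d → ℕ)) : Prop :=
  ∀ t u c, Nat.card {v : Vertex (profile N) // v.1 = t ∧ τ v = (u, c)} = N t u c

/-- The set of all vectors `c` which occur in `N`. -/
def degreeSupport (N : CompleteData d) : Finset (Fin d → ℕ) :=
  Finset.univ.biUnion fun t => Finset.univ.biUnion fun u => (N t u).support

lemma support_subset_degreeSupport (N : CompleteData d) (t : Fin d) (u : Fin (d + 1)) :
    (N t u).support ⊆ degreeSupport N := by
  intro c hc
  simp only [degreeSupport, Finset.mem_biUnion, Finset.mem_univ, true_and]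
  exact ⟨t, u, hc⟩

variable {N : CompleteData d} {τ : Vertex (profile N) → Fin (d + 1) × (Fin d → ℕ)}

lemma IsAssignment.mem_degreeSupport (h : IsAssignment N τ) (v : Vertex (profile N)) :
    (τ v).2 ∈ degreeSupport N := by
  refine support_subset_degreeSupport N v.1 (τ v).1 ?_
  rw [Finsupp.mem_support_iff, ← h]
  have : Nonempty {w : Vertex (profile N) // w.1 = v.1 ∧ τ w = ((τ v).1, (τ v).2)} := ⟨v, rfl, rfl⟩
  exact Nat.card_pos.ne'

/-- Sums over vertices as sums over complete degree types. -/
lemma IsAssignment.sum_eq (h : IsAssignment N τ) (w : Fin d → Fin (d + 1) → (Fin d → ℕ) → ℕ) :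
    ∑ v, w v.1 (τ v).1 (τ v).2 = ∑ t, ∑ u, (N t u).sum fun c a => w t u c * a := by
  classical
  have h1 : ∀ t u, (N t u).sum (fun c a => w t u c * a) =
      ∑ c ∈ degreeSupport N, ∑ v : Vertex (profile N),
        if v.1 = t ∧ τ v = (u, c) then w t u c else 0 := fun t u => by
    rw [Finsupp.sum_of_support_subset _ (support_subset_degreeSupport N t u) _ (by simp)]
    refine Finset.sum_congr rfl fun c _ => ?_
    rw [← h, natCard_subtype_eq_sum, Finset.mul_sum]
    exact Finset.sum_congr rfl fun v _ => by split_ifs <;> simp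
  simp only [h1]
  simp_rw [Finset.sum_comm (t := (Finset.univ : Finset (Vertex (profile N))))]
  refine Finset.sum_congr rfl fun v _ => ?_
  rw [Finset.sum_eq_single v.1, Finset.sum_eq_single (τ v).1, Finset.sum_eq_single (τ v).2]
  · simp
  · intro c _ hc
    exact if_neg fun h2 => hc (congrArg Prod.snd h2.2).symm
  · exact fun h2 => absurd (h.mem_degreeSupport v) h2
  · intro u _ hu
    exact Finset.sum_eq_zero fun c _ => if_neg fun h2 => hu (congrArg Prod.fst h2.2).symm
  · simp
  · intro t _ ht
    exact Finset.sum_eq_zero fun u _ => Finset.sum_eq_zero fun c _ => if_neg fun h2 => ht h2.1.symm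
  · simp

lemma IsAssignment.m₂_eq (h : IsAssignment N τ) (t : Fin d) (u : Fin (d + 1)) :
    m₂ N t u = Nat.card {v : Vertex (profile N) // v.1 = t ∧ (τ v).1 = u} := by
  rw [natCard_subtype_eq_sum, h.sum_eq fun t' u' _ => if t' = t ∧ u' = u then 1 else 0,
    Finset.sum_eq_single t, Finset.sum_eq_single u]
  · simp [m₂]
  · intro u' _ hu
    simp [hu]
  · simp
  · intro t' _ ht
    simp [ht]
  · simp

lemma IsAssignment.m₃_eq (h : IsAssignment N τ) (s t : Fin d) (u : Fin (d + 1)) :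
    m₃ N s t u = ∑ v : Vertex (profile N), if v.1 = t ∧ (τ v).1 = u then (τ v).2 s else 0 := by
  rw [h.sum_eq fun t' u' c => if t' = t ∧ u' = u then c s else 0,
    Finset.sum_eq_single t, Finset.sum_eq_single u]
  · simp [m₃]
  · intro u' _ hu
    simp [hu]
  · simp
  · intro t' _ ht
    simp [ht]
  · simp

lemma IsAssignment.sum_m₃_eq (h : IsAssignment N τ) (s t : Fin d) :
    ∑ u, m₃ N s t u = ∑ v : Vertex (profile N), if v.1 = t then (τ v).2 s else 0 := by
  simp only [h.m₃_eq]
  rw [Finset.sum_comm]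
  refine Finset.sum_congr rfl fun v _ => ?_
  rw [Finset.sum_eq_single (τ v).1]
  · simp
  · intro u _ hu
    exact if_neg fun h2 => hu h2.2.symm
  · simp

lemma IsAssignment.indegreeCount_eq (h : IsAssignment N τ) (k : ℕ) :
    indegreeCount N k = ∑ v, ∑ s, if (τ v).2 s = k then 1 else 0 := by
  rw [h.sum_eq fun _ _ c => ∑ s, if c s = k then 1 else 0, indegreeCount, Finset.sum_comm]
  refine Finset.sum_congr rfl fun t _ => ?_
  rw [Finset.sum_comm]
  refine Finset.sum_congr rfl fun u _ => ?_
  simp only [Finsupp.sum, Finset.sum_mul]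
  rw [Finset.sum_comm]
  simp

/-- Grouping the pairs (vertex, type) by child count shows that the product of the `c_s!` depends on
`N` alone, not on the assignment. -/
lemma IsAssignment.finprod_indegreeCount (h : IsAssignment N τ) :
    ∏ᶠ k : ℕ, ((k ! : ℚ) ^ indegreeCount N k) = ((∏ v, ∏ s, ((τ v).2 s)! : ℕ) : ℚ) := by
  classical
  have hc : ∀ k, indegreeCount N k = (Finset.univ.filter
      fun p : Vertex (profile N) × Fin d => (τ p.1).2 p.2 = k).card := fun k => by
    rw [h.indegreeCount_eq, Finset.card_filter, Fintype.sum_prod_type]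
  rw [finprod_eq_prod_of_mulSupport_subset (s := Finset.univ.image
    fun p : Vertex (profile N) × Fin d => (τ p.1).2 p.2)]
  · rw [← Fintype.prod_prod_type' fun (v : Vertex (profile N)) s => ((τ v).2 s)!,
      Finset.prod_comp (fun k : ℕ => k !) fun p : Vertex (profile N) × Fin d => (τ p.1).2 p.2]
    push_cast
    simp only [hc]
  · intro k hk
    by_contra hk'
    apply hk
    have : indegreeCount N k = 0 := by
      rw [hc, Finset.card_eq_zero, Finset.filter_eq_empty_iff]
      intro p _ hp
      exact hk' (Finset.mem_coe.mpr (Finset.mem_image.mpr ⟨p, Finset.mem_univ _, hp⟩))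
    simp [this]

lemma card_vertex_type (n : Fin d → ℕ) (t : Fin d) :
    Nat.card {v : Vertex n // v.1 = t} = n t := by
  rw [Nat.card_congr (Equiv.sigmaSubtype t), Nat.card_eq_fintype_card, Fintype.card_fin]

lemma exists_isAssignment (N : CompleteData d) : ∃ τ, IsAssignment N τ := by
  obtain ⟨f, hf⟩ := exists_card_fiber_fiber_eq (fun v : Vertex (profile N) => v.1)
    (fun t => (Finsupp.equivFunOnFinite.symm (N t)).uncurry) (fun t => by
      rw [card_vertex_type, Finsupp.sum_uncurry_index (g := fun _ a => a), profile,
        Finsupp.sum_fintype _ _ (by simp)]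
      rfl)
  exact ⟨f, fun t u c => hf t (u, c)⟩

/-- The type-preserving permutations, `∏ n_t!` in number, act transitively on assignments, with
stabilizers of order `∏ N_{t,u,c}!`. -/
lemma card_isAssignment_mul (N : CompleteData d) :
    Nat.card {τ // IsAssignment N τ} * ∏ t, ∏ u, (N t u).prod (fun _ a => a !) =
      ∏ t, (profile N t)! := by
  classical
  obtain ⟨τ₀, h₀⟩ := exists_isAssignment N
  have h := card_sameFiberCount_mul (fun v : Vertex (profile N) => v.1) τ₀ fun _ => True
  have e1 : ∀ τ, SameFiberCount (fun v : Vertex (profile N) => v.1) τ₀ τ ∧ True ↔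
      IsAssignment N τ := fun τ => by
    simp only [SameFiberCount, IsAssignment, and_true, Prod.forall]
    exact forall₃_congr fun t u c => by rw [h₀ t u c]
  simp only [e1, and_true] at h
  rw [Nat.card_congr (permFiberEquiv _), Nat.card_pi] at h
  simp only [Nat.card_perm, card_vertex_type] at h
  rw [← h]
  congr 1
  rw [Finset.prod_subset (s₂ := Finset.univ ×ˢ Finset.univ ×ˢ degreeSupport N)]
  · rw [Finset.prod_product]
    refine Finset.prod_congr rfl fun t _ => ?_
    rw [Finset.prod_product]
    refine Finset.prod_congr rfl fun u _ => ?_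
    rw [Finsupp.prod_of_support_subset _ (support_subset_degreeSupport N t u) _ (by simp)]
    exact Finset.prod_congr rfl fun c _ => by rw [← h₀]
  · intro p hp
    simp only [Finset.mem_image] at hp
    obtain ⟨v, -, rfl⟩ := hp
    simp only [Finset.mem_product, Finset.mem_univ, true_and]
    exact h₀.mem_degreeSupport v
  · intro p _ hp
    have : IsEmpty {v : Vertex (profile N) // v.1 = p.1 ∧ τ₀ v = p.2} := by
      rw [isEmpty_subtype]
      rintro v ⟨h2, h3⟩
      refine hp ?_
      simp only [Finset.mem_image]
      exact ⟨v, Finset.mem_univ _, Prod.ext h2 h3⟩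
    rw [Nat.card_of_isEmpty, Nat.factorial_zero]

/-! ### The complete degree types of a tree -/

section DegreeType

variable {n : Fin d → ℕ}

open Classical in
/-- The type of the parent of a vertex. -/
def parentType (r : Vertex n) (f : Vertex n → Vertex n) (v : Vertex n) : Fin (d + 1) :=
  if v = r then Fin.last d else (f v).1.castSucc

/-- The number of preimages, other than `r`, of each type. -/
def childCount (r : Vertex n) (f : Vertex n → Vertex n) (v : Vertex n) (s : Fin d) : ℕ :=
  Nat.card {w : Vertex n // w.1 = s ∧ w ≠ r ∧ f w = v}

/-- The parent type and the numbers of children of each type. -/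
def degreeType (r : Vertex n) (f : Vertex n → Vertex n) (v : Vertex n) :
    Fin (d + 1) × (Fin d → ℕ) :=
  (parentType r f v, childCount r f v)

lemma parentType_eq_last_iff {r : Vertex n} {f : Vertex n → Vertex n} {v : Vertex n} :
    parentType r f v = Fin.last d ↔ v = r := by
  unfold parentType
  split_ifs with h
  · simp [h]
  · simp [h, (Fin.castSucc_lt_last _).ne]

lemma hasCompleteDegreeType_iff (T : RootedVertexTree (Vertex n)) (v : Vertex n) (t : Fin d)
    (u : Fin (d + 1)) (c : Fin d → ℕ) :
    HasCompleteDegreeType T v t u c ↔ v.1 = t ∧ degreeType T.root T.parent v = (u, c) := by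
  unfold HasCompleteDegreeType degreeType
  rw [Prod.mk.injEq]
  refine and_congr_right fun _ => and_congr ?_ ?_
  · unfold HasParentType parentType
    simp only [RootedVertexTree.orientation_adj_iff]
    by_cases h : v = T.root
    · simp [h, eq_comm]
    · simp [h, eq_comm]
  · rw [funext_iff]
    simp only [ch, childCount, RootedVertexTree.orientation_adj_iff]

end DegreeType

lemma mem_treesWithData_iff (ρ : Fin d) (N : CompleteData d)
    (T : RootedVertexTree (Vertex (profile N))) :
    T ∈ treesWithData ρ N ↔ T.root.1 = ρ ∧ IsAssignment N (degreeType T.root T.parent) := by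
  simp only [treesWithData, Set.mem_ofPred_eq, cayleyTrees, hasCompleteDegreeType_iff]
  rfl

/-- Double counting of the arcs from type `s` to type `t`; this yields the second compatibility
condition. -/
lemma sum_childCount {n : Fin d → ℕ} (r : Vertex n) (f : Vertex n → Vertex n) (s t : Fin d) :
    (∑ w : Vertex n, if w.1 = t then childCount r f w s else 0) =
      Nat.card {v : Vertex n // v.1 = s ∧ parentType r f v = t.castSucc} := by
  classical
  simp only [childCount, natCard_subtype_eq_sum]
  have : ∀ w : Vertex n,
      (if w.1 = t then ∑ v : Vertex n, (if v.1 = s ∧ v ≠ r ∧ f v = w then 1 else 0) else 0) =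
      ∑ v : Vertex n, if w = f v then (if v.1 = s ∧ v ≠ r ∧ w.1 = t then 1 else 0) else 0 := by
    intro w
    split_ifs with h
    · refine Finset.sum_congr rfl fun v _ => ?_
      by_cases hw : w = f v
      · simp [hw, ← h]
      · simp [hw, Ne.symm hw]
    · simp [h]
  simp only [this]
  rw [Finset.sum_comm]
  refine Finset.sum_congr rfl fun v _ => ?_
  rw [Finset.sum_ite_eq' Finset.univ (f v)]
  unfold parentType
  by_cases hv : v = r
  · simp [hv, (Fin.castSucc_lt_last _).ne']
  · simp [hv]

theorem compatible_of_mem_treesWithData {ρ : Fin d} {N : CompleteData d}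
    {T : RootedVertexTree (Vertex (profile N))} (hT : T ∈ treesWithData ρ N) : Compatible ρ N := by
  obtain ⟨hr, h⟩ := (mem_treesWithData_iff ρ N T).mp hT
  refine ⟨fun s => ?_, fun s t => ?_⟩
  · rw [h.m₂_eq]
    simp only [degreeType, parentType_eq_last_iff]
    split_ifs with hs
    · rw [Nat.card_eq_one_iff_unique]
      exact ⟨⟨fun a b => Subtype.ext (a.2.2.trans b.2.2.symm)⟩, ⟨T.root, hr.trans hs.symm, rfl⟩⟩
    · have : IsEmpty {v : Vertex (profile N) // v.1 = s ∧ v = T.root} := by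
        rw [isEmpty_subtype]
        rintro v ⟨h1, rfl⟩
        exact hs (h1.symm.trans hr)
      exact Nat.card_of_isEmpty
  · rw [h.m₂_eq, h.sum_m₃_eq]
    exact (sum_childCount _ _ _ _).symm

end MultitypeCayley

/-! ### Trees realising a fixed assignment. -/

namespace MultitypeCayley

variable {d : ℕ} {ρ : Fin d} {N : CompleteData d}
  {τ : Vertex (profile N) → Fin (d + 1) × (Fin d → ℕ)}

lemma IsAssignment.m₂_pos (h : IsAssignment N τ) (v : Vertex (profile N)) :
    0 < m₂ N v.1 (τ v).1 := by
  rw [h.m₂_eq]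
  have : Nonempty {w : Vertex (profile N) // w.1 = v.1 ∧ (τ w).1 = (τ v).1} := ⟨v, rfl, rfl⟩
  exact Nat.card_pos

lemma IsAssignment.exists_root (h : IsAssignment N τ) (hN : Compatible ρ N) :
    ∃ r : Vertex (profile N), r.1 = ρ ∧ ∀ v, (τ v).1 = Fin.last d ↔ v = r := by
  have h1 := hN.1 ρ
  rw [if_pos rfl, h.m₂_eq, Nat.card_eq_one_iff_unique] at h1
  obtain ⟨hs, ⟨r, hr, hτ⟩⟩ := h1
  refine ⟨r, hr, fun v => ⟨fun hv => ?_, fun hv => hv ▸ hτ⟩⟩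
  have h2 := h.m₂_pos v
  rw [hv, hN.1] at h2
  have h3 : v.1 = ρ := by
    by_contra h3
    rw [if_neg h3] at h2
    exact lt_irrefl _ h2
  exact congrArg Subtype.val (hs.elim ⟨v, h3, hv⟩ ⟨r, hr, hτ⟩)

/-- The vertex of `G(N)` formed by the type of a vertex and its assigned parent type. -/
def IsAssignment.cls (h : IsAssignment N τ) (v : Vertex (profile N)) : GVertex N :=
  ⟨(v.1, (τ v).1), h.m₂_pos v⟩

lemma IsAssignment.cls_eq_iff (h : IsAssignment N τ) {v : Vertex (profile N)} {x : GVertex N} :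
    h.cls v = x ↔ v.1 = x.1.1 ∧ (τ v).1 = x.1.2 := by
  rw [Subtype.ext_iff, Prod.ext_iff]
  rfl

lemma IsAssignment.card_cls (h : IsAssignment N τ) (x : GVertex N) :
    Nat.card {v // h.cls v = x} = m₂ N x.1.1 x.1.2 := by
  rw [h.m₂_eq]
  simp only [h.cls_eq_iff]

lemma IsAssignment.exists_cls_eq (h : IsAssignment N τ) (x : GVertex N) : ∃ v, h.cls v = x := by
  have h1 := x.2
  rw [← h.card_cls] at h1
  obtain ⟨v⟩ := (Nat.card_pos_iff.mp h1).1
  exact ⟨v.1, v.2⟩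

variable (τ) in
/-- The number of vertices in the class `p` whose parent is `w`, as prescribed by `τ`. -/
def slotCount (r : Vertex (profile N)) (p : Fin d × Fin (d + 1)) (w : Vertex (profile N)) : ℕ :=
  if p.2 = Fin.last d then if w = r then 1 else 0
  else if p.2 = w.1.castSucc then (τ w).2 p.1 else 0

lemma slotCount_last (r : Vertex (profile N)) (s : Fin d) (w : Vertex (profile N)) :
    slotCount τ r (s, Fin.last d) w = if w = r then 1 else 0 := by
  simp [slotCount]

lemma slotCount_castSucc (r : Vertex (profile N)) (s t : Fin d) (w : Vertex (profile N)) :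
    slotCount τ r (s, t.castSucc) w = if w.1 = t then (τ w).2 s else 0 := by
  simp [slotCount, (Fin.castSucc_lt_last _).ne, eq_comm]

/-- An empty class is not a vertex of `G(N)`; this ensures that no child count is lost by ignoring
it. -/
lemma IsAssignment.apply_eq_zero (h : IsAssignment N τ) (hN : Compatible ρ N)
    {w : Vertex (profile N)} {s : Fin d} (hm : m₂ N s w.1.castSucc = 0) : (τ w).2 s = 0 := by
  rw [hN.2, h.sum_m₃_eq, Finset.sum_eq_zero_iff] at hm
  simpa using hm w (Finset.mem_univ _)

/-- Turns realising `τ` into a condition on fiber sizes over classes, the form to which the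
permutation count applies. -/
lemma degreeType_eq_iff (h : IsAssignment N τ) (hN : Compatible ρ N) {r : Vertex (profile N)}
    (hr : ∀ v, (τ v).1 = Fin.last d ↔ v = r) (f : Vertex (profile N) → Vertex (profile N)) :
    f r = r ∧ degreeType r f = τ ↔
      ∀ x w, Nat.card {v // h.cls v = x ∧ f v = w} = slotCount τ r x.1 w := by
  classical
  constructor
  · rintro ⟨hf, hτ⟩ ⟨⟨s, u⟩, hx⟩ w
    have hp : ∀ v, (τ v).1 = parentType r f v := fun v => by rw [← hτ]; rfl
    simp only [h.cls_eq_iff]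
    induction u using Fin.lastCases with
    | last =>
      obtain ⟨v, hv⟩ := h.exists_cls_eq ⟨_, hx⟩
      obtain ⟨hv1, hv2⟩ := h.cls_eq_iff.mp hv
      obtain rfl := (hr v).mp hv2
      rw [slotCount_last]
      simp only [hr]
      split_ifs with hw
      · rw [Nat.card_eq_one_iff_unique]
        exact ⟨⟨fun a b => Subtype.ext (a.2.1.2.trans b.2.1.2.symm)⟩,
          ⟨v, ⟨hv1, rfl⟩, hf.trans hw.symm⟩⟩
      · have : IsEmpty {v' : Vertex (profile N) // (v'.1 = s ∧ v' = v) ∧ f v' = w} := by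
          rw [isEmpty_subtype]
          rintro _ ⟨⟨-, rfl⟩, h2⟩
          exact hw (h2.symm.trans hf)
        exact Nat.card_of_isEmpty
    | cast t =>
      rw [slotCount_castSucc]
      have hp' : ∀ v, (τ v).1 = t.castSucc ↔ v ≠ r ∧ (f v).1 = t := fun v => by
        rw [hp, parentType]
        split_ifs with hv
        · simp [hv, (Fin.castSucc_lt_last _).ne']
        · simp [hv]
      simp only [hp']
      split_ifs with hw
      · rw [← hτ]
        refine Nat.card_congr (Equiv.subtypeEquivRight fun v => ?_)
        constructor
        · rintro ⟨⟨h1, h2, -⟩, h3⟩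
          exact ⟨h1, h2, h3⟩
        · rintro ⟨h1, h2, h3⟩
          exact ⟨⟨h1, h2, by rw [h3, hw]⟩, h3⟩
      · have : IsEmpty {v : Vertex (profile N) // (v.1 = s ∧ v ≠ r ∧ (f v).1 = t) ∧ f v = w} := by
          rw [isEmpty_subtype]
          rintro v ⟨⟨-, -, h1⟩, rfl⟩
          exact hw h1
        exact Nat.card_of_isEmpty
  · intro hc
    have hτr : (τ r).1 = Fin.last d := (hr r).mpr rfl
    have hf : f r = r := by
      have h1 := hc (h.cls r) r
      change _ = slotCount τ r (r.1, (τ r).1) r at h1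
      rw [hτr, slotCount_last, if_pos rfl, Nat.card_eq_one_iff_unique] at h1
      obtain ⟨v, hv1, hv2⟩ := h1.2
      rw [h.cls_eq_iff] at hv1
      obtain rfl := (hr v).mp (hv1.2.trans hτr)
      exact hv2
    have hp : ∀ v, v ≠ r → (τ v).1 = (f v).1.castSucc := by
      intro v hv
      -- The fiber containing `v` is nonempty, so its prescribed size is positive, which forces the
      -- type of `f v` to be the assigned parent type.
      have h1 := hc (h.cls v) (f v)
      have : Nonempty {v' // h.cls v' = h.cls v ∧ f v' = f v} := ⟨v, rfl, rfl⟩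
      have h2 : 0 < slotCount τ r (h.cls v).1 (f v) := h1 ▸ Nat.card_pos
      by_contra h3
      change 0 < slotCount τ r (v.1, (τ v).1) (f v) at h2
      rw [slotCount, if_neg (fun h4 => hv ((hr v).mp h4)), if_neg h3] at h2
      exact lt_irrefl _ h2
    refine ⟨hf, funext fun w => Prod.ext ?_ (funext fun s => ?_)⟩
    · change parentType r f w = _
      rw [parentType]
      split_ifs with hw
      · rw [hw, hτr]
      · exact (hp w hw).symm
    · change childCount r f w s = _
      have e : ∀ v : Vertex (profile N), v.1 = s ∧ v ≠ r ∧ f v = w ↔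
          (v.1 = s ∧ (τ v).1 = w.1.castSucc) ∧ f v = w := by
        intro v
        constructor
        · rintro ⟨h1, h2, rfl⟩
          exact ⟨⟨h1, hp v h2⟩, rfl⟩
        · rintro ⟨⟨h1, h2⟩, h3⟩
          refine ⟨h1, ?_, h3⟩
          rintro rfl
          rw [hτr] at h2
          exact (Fin.castSucc_lt_last _).ne' h2
      unfold childCount
      simp only [e]
      rcases Nat.eq_zero_or_pos (m₂ N s w.1.castSucc) with hm | hm
      · rw [h.apply_eq_zero hN hm, Nat.card_eq_zero]
        refine Or.inl (isEmpty_subtype _ |>.mpr ?_)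
        rintro v ⟨⟨rfl, h2⟩, -⟩
        have := h.m₂_pos v
        rw [h2] at this
        omega
      · have h1 := hc ⟨(s, w.1.castSucc), hm⟩ w
        simp only [h.cls_eq_iff] at h1
        rw [h1, slotCount_castSucc, if_pos rfl]

/-- Compatibility says that each class has as many vertices as there are child slots for it. The map
obtained need not be absorbing; it only serves as a base point for the permutations. -/
lemma IsAssignment.exists_parent (h : IsAssignment N τ) (hN : Compatible ρ N)
    (r : Vertex (profile N)) :
    ∃ f : Vertex (profile N) → Vertex (profile N),
      ∀ x w, Nat.card {v // h.cls v = x ∧ f v = w} = slotCount τ r x.1 w := by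
  refine exists_card_fiber_fiber_eq h.cls
    (fun x => Finsupp.equivFunOnFinite.symm (slotCount τ r x.1)) fun x => ?_
  rw [h.card_cls, Finsupp.sum_fintype _ _ (by simp)]
  change ∑ w, slotCount τ r x.1 w = _
  obtain ⟨⟨s, u⟩, hx⟩ := x
  induction u using Fin.lastCases with
  | last =>
    rw [hN.1] at hx
    simp only [slotCount_last, hN.1]
    rw [Finset.sum_ite_eq' Finset.univ r, if_pos (Finset.mem_univ _)]
    split_ifs at hx ⊢
    · rfl
    · exact absurd hx (lt_irrefl _)
  | cast t =>
    simp only [slotCount_castSucc]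
    rw [hN.2, h.sum_m₃_eq]

lemma IsAssignment.prod_slotCount (h : IsAssignment N τ) (hN : Compatible ρ N)
    (r : Vertex (profile N)) :
    ∏ x : GVertex N, ∏ w, (slotCount τ r x.1 w)! = ∏ w, ∏ s, ((τ w).2 s)! := by
  classical
  rw [Finset.prod_comm]
  refine Finset.prod_congr rfl fun w _ => ?_
  rw [← Finset.prod_subtype (Finset.univ.filter fun p : Fin d × Fin (d + 1) => 0 < m₂ N p.1 p.2)
    (by simp) fun p => (slotCount τ r p w)!, Finset.prod_subset (Finset.subset_univ _),
    Fintype.prod_prod_type]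
  · refine Finset.prod_congr rfl fun s _ => ?_
    rw [Fin.prod_univ_castSucc, slotCount_last]
    simp only [slotCount_castSucc]
    rw [Finset.prod_eq_single w.1]
    · rw [if_pos rfl]
      split_ifs <;> simp
    · intro t _ ht
      rw [if_neg ht.symm, Nat.factorial_zero]
    · simp
  · rintro ⟨s, u⟩ - hp
    have hm : m₂ N s u = 0 := by simpa using hp
    induction u using Fin.lastCases with
    | last =>
      rw [slotCount_last]
      split_ifs <;> simp
    | cast t =>
      rw [slotCount_castSucc]
      split_ifs with hw
      · rw [h.apply_eq_zero hN (hw ▸ hm), Nat.factorial_zero]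
      · rfl

/-- Summing the slots over the class `y` gives `m₃`. The root class is excluded because its only
slot is the loop at `r`. -/
lemma IsAssignment.card_arc (h : IsAssignment N τ) {r : Vertex (profile N)}
    (hr : ∀ v, (τ v).1 = Fin.last d ↔ v = r) {f : Vertex (profile N) → Vertex (profile N)}
    (hf : ∀ x w, Nat.card {v // h.cls v = x ∧ f v = w} = slotCount τ r x.1 w) {x y : GVertex N}
    (hx : x ≠ h.cls r) :
    Nat.card {v // h.cls v = x ∧ h.cls (f v) = y} =
      if x.1.2 = y.1.1.castSucc then m₃ N x.1.1 y.1.1 y.1.2 else 0 := by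
  classical
  have hl : x.1.2 ≠ Fin.last d := by
    intro h1
    obtain ⟨v, rfl⟩ := h.exists_cls_eq x
    rw [(hr v).mp h1] at hx
    exact hx rfl
  have h1 : Nat.card {v // h.cls v = x ∧ h.cls (f v) = y} =
      ∑ w, if h.cls w = y then slotCount τ r x.1 w else 0 := by
    simp only [← hf, natCard_subtype_eq_sum]
    have : ∀ w, (if h.cls w = y then ∑ v, (if h.cls v = x ∧ f v = w then 1 else 0) else 0) =
        ∑ v, if w = f v then (if h.cls v = x ∧ h.cls w = y then 1 else 0) else 0 := by
      intro w
      split_ifs with hw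
      · refine Finset.sum_congr rfl fun v _ => ?_
        by_cases hv : w = f v
        · simp [hv, ← hw]
        · simp [hv, Ne.symm hv]
      · simp [hw]
    simp only [this]
    rw [Finset.sum_comm]
    refine Finset.sum_congr rfl fun v _ => ?_
    rw [Finset.sum_ite_eq' Finset.univ (f v), if_pos (Finset.mem_univ _)]
  rw [h1]
  simp only [slotCount, if_neg hl, h.cls_eq_iff]
  split_ifs with hxy
  · rw [h.m₃_eq]
    refine Finset.sum_congr rfl fun w _ => ?_
    split_ifs with h2 h3
    · rfl
    · exact absurd (hxy.trans (by rw [h2.1])) h3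
    · rfl
  · refine Finset.sum_eq_zero fun w _ => ?_
    split_ifs with h2 h3
    · exact absurd (h3.trans (by rw [h2.1])) hxy
    · rfl
    · rfl

/-- The right side runs over all rooted trees on the classes; a tree using an arc outside `G(N)` has
a zero factor, since no vertex makes that transition. -/
lemma IsAssignment.spanningTreeSum_eq (h : IsAssignment N τ) {r : Vertex (profile N)}
    (hρ : r.1 = ρ) (hr : ∀ v, (τ v).1 = Fin.last d ↔ v = r)
    {f : Vertex (profile N) → Vertex (profile N)}
    (hf : ∀ x w, Nat.card {v // h.cls v = x ∧ f v = w} = slotCount τ r x.1 w) :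
    spanningTreeSum ρ N = ∑ A : RootedVertexTree (GVertex N) with A.root = h.cls r,
      ∏ e ∈ A.arcs, Nat.card {v // h.cls v = e.1 ∧ h.cls (f v) = e.2} := by
  classical
  have hroot : ∀ x : GVertex N, x.1 = (ρ, Fin.last d) ↔ x = h.cls r := fun x => by
    rw [Subtype.ext_iff]
    change _ ↔ x.1 = (r.1, (τ r).1)
    rw [hρ, (hr r).mpr rfl]
  unfold spanningTreeSum
  simp only [hroot]
  rw [Finset.sum_filter, Finset.sum_filter]
  refine Finset.sum_congr rfl fun A _ => ?_
  by_cases hA : A.root = h.cls r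
  swap
  · simp [hA]
  have harc : ∀ e ∈ A.arcs, Nat.card {v // h.cls v = e.1 ∧ h.cls (f v) = e.2} =
      if e.1.1.2 = e.2.1.1.castSucc then m₃ N e.1.1.1 e.2.1.1 e.2.1.2 else 0 := by
    intro e he
    simp only [RootedVertexTree.arcs, Finset.mem_filter, Finset.mem_univ, true_and] at he
    refine h.card_arc hr hf ?_
    rw [← hA]
    exact (A.orientation_adj_iff.mp he).1
  rw [if_pos hA, Finset.prod_congr rfl harc]
  by_cases hS : A.IsSpanningTreeOf (G N)
  · rw [if_pos ⟨hS, hA⟩]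
    refine Finset.prod_congr rfl fun e he => ?_
    simp only [RootedVertexTree.arcs, Finset.mem_filter, Finset.mem_univ, true_and] at he
    exact (if_pos (hS he)).symm
  · rw [if_neg fun h1 => hS h1.1]
    have : ∃ x y, A.orientation.Adj x y ∧ ¬ (G N).Adj x y := by
      by_contra! h1
      exact hS fun x y hxy => h1 x y hxy
    obtain ⟨x, y, hxy, hG⟩ := this
    refine (Finset.prod_eq_zero (i := (x, y)) ?_ (if_neg hG)).symm
    simpa [RootedVertexTree.arcs] using hxy

/-- The number of trees in which every vertex has its assigned complete degree type. -/
lemma IsAssignment.card_trees_mul (h : IsAssignment N τ) (hN : Compatible ρ N) :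
    Nat.card {T : RootedVertexTree (Vertex (profile N)) //
        T.root.1 = ρ ∧ degreeType T.root T.parent = τ} * ∏ w, ∏ s, ((τ w).2 s)! =
      (∏ x : GVertex N, (m₂ N x.1.1 x.1.2 - 1)!) * spanningTreeSum ρ N := by
  obtain ⟨r, hρ, hr⟩ := h.exists_root hN
  obtain ⟨f, hf⟩ := h.exists_parent hN r
  obtain ⟨hfr, -⟩ := (degreeType_eq_iff h hN hr f).mpr hf
  have hκr : ∀ w, h.cls w = h.cls r → w = r := fun w hw =>
    (hr w).mp ((h.cls_eq_iff.mp hw).2.trans ((hr r).mpr rfl))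
  choose ℓ hℓ using h.exists_cls_eq
  have key := card_parent_mul h.cls ℓ hℓ hκr f hfr
  simp only [hf, h.prod_slotCount hN, h.card_cls] at key
  rw [h.spanningTreeSum_eq hρ hr hf]
  refine Eq.trans ?_ (key.trans (by congr!))
  congr 1
  have e : ∀ f', SameFiberCount h.cls f f' ↔ f' r = r ∧ degreeType r f' = τ := fun f' => by
    rw [degreeType_eq_iff h hN hr]
    simp only [SameFiberCount, hf]
  have hroot : ∀ T : RootedVertexTree (Vertex (profile N)), degreeType T.root T.parent = τ →
      T.root = r := fun T hT => by
    rw [← hr, ← hT]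
    exact parentType_eq_last_iff.mpr rfl
  have hfix : ∀ p : {f' // SameFiberCount h.cls f f' ∧ Absorbing r f'}, p.1 r = r :=
    fun p => ((e _).mp p.2.1).1
  refine Nat.card_congr ⟨fun T => ⟨T.1.parent, ?_⟩,
    fun p => ⟨RootedVertexTree.ofParent p.2.2 (hfix p), ?_⟩, fun T => ?_, fun p => ?_⟩
  · have h1 := hroot T.1 T.2.2
    rw [e, ← h1]
    exact ⟨⟨T.1.parent_root, T.2.2⟩, T.1.absorbing_parent⟩
  · rw [RootedVertexTree.parent_ofParent]
    exact ⟨hρ, ((e _).mp p.2.1).2⟩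
  · refine Subtype.ext (RootedVertexTree.eq_of_parent_eq (hroot T.1 T.2.2).symm ?_)
    rw [RootedVertexTree.parent_ofParent]
  · exact Subtype.ext (RootedVertexTree.parent_ofParent p.2.2 (hfix p))

end MultitypeCayley

/-! ### Summing over assignments and assembling the formula. -/

namespace MultitypeCayley

variable {d : ℕ} {ρ : Fin d} {N : CompleteData d}

/-- The root class has size one and contributes `0! = 1`. Empty classes do too, since `0 - 1 = 0` in
`ℕ`. -/
lemma prod_gVertex_eq (hN : Compatible ρ N) :
    ∏ x : GVertex N, (m₂ N x.1.1 x.1.2 - 1)! =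
      ∏ p : Fin d × Fin d with 0 < m₂ N p.1 p.2.castSucc, (m₂ N p.1 p.2.castSucc - 1)! := by
  classical
  rw [← Finset.prod_subtype (Finset.univ.filter fun p : Fin d × Fin (d + 1) => 0 < m₂ N p.1 p.2)
    (by simp) fun p => (m₂ N p.1 p.2 - 1)!, Finset.prod_subset (Finset.subset_univ _),
    Finset.prod_subset (Finset.subset_univ (Finset.univ.filter _)), Fintype.prod_prod_type,
    Fintype.prod_prod_type]
  · refine Finset.prod_congr rfl fun s _ => ?_
    rw [Fin.prod_univ_castSucc, hN.1]
    split_ifs <;> simp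
  · intro p _ hp
    have hm : m₂ N p.1 p.2.castSucc = 0 := by simpa using hp
    simp [hm]
  · intro p _ hp
    have hm : m₂ N p.1 p.2 = 0 := by simpa using hp
    simp [hm]

/-- By compatibility each `N_{t,d+1,c}` is at most one, so the factors with `u = d + 1` are trivial.
-/
lemma prod_factorial_eq (hN : Compatible ρ N) :
    ∏ t, ∏ u, (N t u).prod (fun _ a => a !) =
      ∏ t, ∏ u : Fin d, (N t u.castSucc).prod fun _ a => a ! := by
  refine Finset.prod_congr rfl fun t _ => ?_
  rw [Fin.prod_univ_castSucc]
  have : (N t (Fin.last d)).prod (fun _ a => a !) = 1 := by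
    refine Finset.prod_eq_one fun c hc => ?_
    have h1 : N t (Fin.last d) c ≤ m₂ N t (Fin.last d) :=
      Finset.single_le_sum (f := fun c => N t (Fin.last d) c) (fun _ _ => Nat.zero_le _) hc
    rw [hN.1] at h1
    rw [Nat.factorial_eq_one]
    split_ifs at h1 <;> omega
  rw [this, mul_one]

theorem ncard_treesWithData_mul (hN : Compatible ρ N)
    {τ : Vertex (profile N) → Fin (d + 1) × (Fin d → ℕ)} (hτ : IsAssignment N τ) :
    (treesWithData ρ N).ncard *
        ((∏ t, ∏ u : Fin d, (N t u.castSucc).prod fun _ a => a !) *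
          ∏ w, ∏ s, ((τ w).2 s)!) =
      (∏ t, (profile N t)!) *
        (∏ p : Fin d × Fin d with 0 < m₂ N p.1 p.2.castSucc, (m₂ N p.1 p.2.castSucc - 1)!) *
        spanningTreeSum ρ N := by
  -- The number of trees per assignment depends only on `N`, so the sum over assignments is a
  -- product.
  have hcard : ∀ τ' : {τ' // IsAssignment N τ'},
      Nat.card {T : RootedVertexTree (Vertex (profile N)) //
        T.root.1 = ρ ∧ degreeType T.root T.parent = τ'.1} =
      Nat.card {T : RootedVertexTree (Vertex (profile N)) //
        T.root.1 = ρ ∧ degreeType T.root T.parent = τ} := fun τ' => by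
    have h1 := τ'.2.card_trees_mul hN
    have h2 := hτ.card_trees_mul hN
    have h3 : ∏ w, ∏ s, ((τ'.1 w).2 s)! = ∏ w, ∏ s, ((τ w).2 s)! := by
      have := τ'.2.finprod_indegreeCount.symm.trans hτ.finprod_indegreeCount
      exact_mod_cast this
    rw [h3, ← h2] at h1
    exact Nat.eq_of_mul_eq_mul_right (Finset.prod_pos fun w _ => Finset.prod_pos fun s _ =>
      Nat.factorial_pos _) h1
  have e : treesWithData ρ N ≃ Σ τ' : {τ' // IsAssignment N τ'},
      {T : RootedVertexTree (Vertex (profile N)) //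
        T.root.1 = ρ ∧ degreeType T.root T.parent = τ'.1} :=
    ⟨fun T => ⟨⟨_, ((mem_treesWithData_iff ρ N T.1).mp T.2).2⟩, T.1,
        ((mem_treesWithData_iff ρ N T.1).mp T.2).1, rfl⟩,
      fun p => ⟨p.2.1, (mem_treesWithData_iff ρ N p.2.1).mpr ⟨p.2.2.1, by
        rw [p.2.2.2]
        exact p.1.2⟩⟩,
      fun _ => rfl, by
      rintro ⟨⟨τ', h⟩, T, h1, h2⟩
      obtain rfl : degreeType T.root T.parent = τ' := h2
      rfl⟩
  have e' := (e.trans (Equiv.sigmaCongrRight fun τ' =>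
    (Finite.card_eq.mp (hcard τ')).some)).trans (Equiv.sigmaEquivProd _ _)
  rw [← Nat.card_coe_set_eq, Nat.card_congr e', Nat.card_prod, ← card_isAssignment_mul,
    prod_factorial_eq hN, ← prod_gVertex_eq hN]
  have h2 := hτ.card_trees_mul hN
  rw [mul_mul_mul_comm, h2]
  ring

end MultitypeCayley

end

open MultitypeCayley in
theorem mainTheorem6 {d : ℕ} (ρ : Fin d) (N : CompleteData d) :
    (Compatible ρ N →
      ((treesWithData ρ N).ncard : ℚ) =
        ((∏ t : Fin d, ((profile N t)! : ℚ)) *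
            ∏ p : Fin d × Fin d with 0 < m₂ N p.1 p.2.castSucc,
              ((m₂ N p.1 p.2.castSucc - 1)! : ℚ)) /
          ((∏ t : Fin d, ∏ u : Fin d, (N t u.castSucc).prod fun _ a => (a ! : ℚ)) *
            ∏ᶠ k : ℕ, ((k ! : ℚ) ^ indegreeCount N k)) *
          (spanningTreeSum ρ N : ℚ)) ∧
    (¬ Compatible ρ N → (treesWithData ρ N).ncard = 0) := by
  refine ⟨fun hN => ?_, fun hN => ?_⟩
  · obtain ⟨τ, hτ⟩ := exists_isAssignment N
    have key := congrArg (Nat.cast : ℕ → ℚ) (ncard_treesWithData_mul hN hτ)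
    rw [hτ.finprod_indegreeCount, div_mul_eq_mul_div, eq_div_iff]
    · simp only [Finsupp.prod] at key ⊢
      push_cast at key ⊢
      exact key
    · simp only [Finsupp.prod]
      norm_cast
      exact (Nat.mul_pos
        (Finset.prod_pos fun _ _ => Finset.prod_pos fun _ _ => Finset.prod_pos fun _ _ =>
          Nat.factorial_pos _)
        (Finset.prod_pos fun _ _ => Finset.prod_pos fun _ _ => Nat.factorial_pos _)).ne'
  · rw [Set.ncard_eq_zero, Set.eq_empty_iff_forall_notMem]
    exact fun T hT => hN (compatible_of_mem_treesWithData hT)
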